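/- Let $M$ be a smooth manifold. For a map $\pi:X\to M$ write $X^{[2]}=\{(x_1,x_2):\pi(x_1)=\pi(x_2)\}$ and $X^{[3]}$ for the threefold fibre product, and let $\pi_i$ be the projection that omits the $i$-th factor. A *bundle gerbe* $(P,X,M)$ on $M$ consists of a smooth manifold $X$, a smooth surjection $\pi:X\to M$ admitting smooth local sections near every point of $M$ and such that $X^{[2]}$, $X^{[3]}$ are submanifolds of $X^2$, $X^3$, a smooth principal $\mathbb{C}^\times$-bundle $P\to X^{[2]}$, and an isomorphism $m=m_P:\pi_1^{-1}P\otimes\pi_3^{-1}P\to\pi_2^{-1}P$ of $\mathbb{C}^\times$-bundles over $X^{[3]}$ (so $m:P_{(x_2,x_3)}\otimes P_{(x_1,x_2)}\to P_{(x_1,x_3)}$) which is associative. A *bundle gerbe morphism* $\bar f=(\hat f,f,\mathrm{id}_M):(P,X,M)\to(Q,Y,M)$ consists of a smooth map $f:X\to Y$ over $M$ and a map of $\mathbb{C}^\times$-bundles $\hat f:P\to Q$ covering $(x_1,x_2)\mapsto(f(x_1),f(x_2))$ with $\hat f(m_P(u\otimes v))=m_Q(\hat f(u)\otimes\hat f(v))$.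 Morphisms are composed by composing $f$ and $\hat f$. For morphisms $\bar f,\bar g:P\to Q$ put $\hat D=(f,g)^{-1}Q$, the $\mathbb{C}^\times$-bundle on $X$ with fibre $Q_{(f(x),g(x))}$ at $x$. For $\xi\in Q_{(f(x_2),g(x_2))}$ and any $p\in P_{(x_1,x_2)}$ let $\phi(\xi)\in Q_{(f(x_1),g(x_1))}$ be the unique point with $m_Q(\hat g(p)\otimes\phi(\xi))=m_Q(\xi\otimes\hat f(p))$. This is independent of $p$ and is a descent isomorphism $\phi:\pi_1^{-1}\hat D\to\pi_2^{-1}\hat D$ over $X^{[2]}$; so $\hat D$ descends to a $\mathbb{C}^\times$-bundle $D_{\bar f,\bar g}$ on $M$. A *transformation* $\theta:\bar f\Rightarrow\bar g$ is a smooth section of $D_{\bar f,\bar g}$; equivalently, it is a smooth section $x\mapsto\theta(x)\in Q_{(f(x),g(x))}$ of $\hat D$ compatible with $\phi$. For $\bar f_1,\bar f_2,\bar f_3:P\to Q$ and transformations $\theta_{12}:\bar f_1\Rightarrow\bar f_2$, $\theta_{23}:\bar f_2\Rightarrow\bar f_3$, their (vertical) composition $\bar f_1\Rightarrow\bar f_3$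 is the image of $\theta_{23}\otimes\theta_{12}$ under the isomorphism $D_{\bar f_2,\bar f_3}\otimes D_{\bar f_1,\bar f_2}\cong D_{\bar f_1,\bar f_3}$ induced by $\xi_{23}\otimes\xi_{12}\mapsto m_Q(\xi_{23}\otimes\xi_{12})$. For $\bar f_1,\bar f_2:P\to Q$, $\bar g_1,\bar g_2:Q\to R$, $\theta:\bar f_1\Rightarrow\bar f_2$ and $\zeta:\bar g_1\Rightarrow\bar g_2$, the horizontal composition $\bar g_1\circ\bar f_1\Rightarrow\bar g_2\circ\bar f_2$ is the image of $\theta\otimes\zeta$ under the isomorphism $D_{\bar f_1,\bar f_2}\otimes D_{\bar g_1,\bar g_2}\cong D_{\bar g_1\circ\bar f_1,\bar g_2\circ\bar f_2}$ induced at $x\in X$ by $\xi\otimes\zeta\mapsto m_R(\hat g_2(\xi)\otimes\zeta)$, where $\xi\in Q_{(f_1(x),f_2(x))}$ and $\zeta\in R_{(g_1(f_1(x)),g_2(f_1(x)))}$. **Proposition.** Bundle gerbes on $M$ (objects), bundle gerbe morphisms (1-arrows) and transformations (2-arrows), with composition of morphisms, identity morphisms, and the vertical and horizontal compositions just described, form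 a 2-category, that is, a bicategory whose associativity and unit 2-isomorphisms are identities: vertical composition makes the morphisms $P\to Q$ and the transformations between them a category, horizontal composition is a functor $\mathrm{Hom}(Q,R)\times\mathrm{Hom}(P,Q)\to\mathrm{Hom}(P,R)$, and this functor is strictly associative and strictly unital. -/

import Mathlib

open scoped Manifold ContDiff Topology

universe u

namespace CstarGerbe

section Bundles

variable {E : Type u} [NormedAddCommGroup E] [NormedSpace ℝ E] {H : Type u} [TopologicalSpace H]
  (I : ModelWithCorners ℝ E H) {B : Type u} [TopologicalSpace B] [ChartedSpace H B]
  {E' : Type u} [NormedAddCommGroup E'] [NormedSpace ℝ E'] {H' : Type u} [TopologicalSpace H']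
  (J : ModelWithCorners ℝ E' H') {C : Type u} [TopologicalSpace C] [ChartedSpace H' C]

/-- `S ⊆ B` is a (split, embedded) submanifold: near each of its points it is the fixed point set of
a smooth retraction of an open set of `B`. -/
def IsSubmanifold (S : Set B) : Prop :=
  ∀ b ∈ S, ∃ U : Set B, IsOpen U ∧ b ∈ U ∧ ∃ r : B → B, ContMDiffOn I I ∞ r U ∧
    (∀ x ∈ U, r x ∈ S) ∧ ∀ x ∈ U ∩ S, r x = x

/-- On `A` the map `σ` is the multiple of `τ` by a smooth function with values in `ℂˣ`. -/
def SmoothMultiple {T : Type u} [MulAction ℂˣ T] (A : Set B) (σ τ : B → T) : Prop :=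
  ∃ g : B → ℂˣ, ContMDiffOn I 𝓘(ℝ, ℂ) ∞ g A ∧ ∀ b ∈ A, σ b = g b • τ b

namespace SmoothMultiple

variable {I J} {T : Type u} [MulAction ℂˣ T] {A A' : Set B} {σ τ ρ : B → T}

theorem refl (A : Set B) (σ : B → T) : SmoothMultiple I A σ σ :=
  ⟨fun _ => 1, contMDiffOn_const, fun _ _ => (one_smul _ _).symm⟩

theorem symm (h : SmoothMultiple I A σ τ) : SmoothMultiple I A τ σ := by
  obtain ⟨g, hg, h⟩ := h
  exact ⟨fun b => (g b)⁻¹, hg.inv, fun b hb => by rw [h b hb, inv_smul_smul]⟩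

theorem trans (h : SmoothMultiple I A σ τ) (h' : SmoothMultiple I A τ ρ) :
    SmoothMultiple I A σ ρ := by
  obtain ⟨g, hg, h⟩ := h
  obtain ⟨g', hg', h'⟩ := h'
  exact ⟨fun b => g b * g' b, hg.mul hg', fun b hb => by rw [h b hb, h' b hb, mul_smul]⟩

theorem mono (h : SmoothMultiple I A σ τ) (hA : A' ⊆ A) : SmoothMultiple I A' σ τ := by
  obtain ⟨g, hg, h⟩ := h
  exact ⟨g, hg.mono hA, fun b hb => h b (hA hb)⟩

theorem comp {D : Set C} {F : C → B} (h : SmoothMultiple I A σ τ)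
    (hF : ContMDiffOn J I ∞ F D) (hD : Set.MapsTo F D A) :
    SmoothMultiple J D (σ ∘ F) (τ ∘ F) := by
  obtain ⟨g, hg, h⟩ := h
  exact ⟨g ∘ F, hg.comp hF hD, fun b hb => h _ (hD hb)⟩

theorem congr_left {σ' : B → T} (h : SmoothMultiple I A σ τ) (hσ : ∀ b ∈ A, σ' b = σ b) :
    SmoothMultiple I A σ' τ := by
  obtain ⟨g, hg, h⟩ := h
  exact ⟨g, hg, fun b hb => by rw [hσ b hb, h b hb]⟩

theorem of_local (free : ∀ (z : ℂˣ) (p : T), z • p = p → z = 1)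
    (h : ∀ b ∈ A, ∃ U : Set B, IsOpen U ∧ b ∈ U ∧ SmoothMultiple I (A ∩ U) σ τ) :
    SmoothMultiple I A σ τ := by
  classical
  have key : ∀ (z w : ℂˣ) (p : T), z • p = w • p → z = w := by
    intro z w p hp
    have : (w⁻¹ * z) • p = p := by rw [mul_smul, hp, inv_smul_smul]
    exact (inv_mul_eq_one.mp (free _ _ this)).symm
  choose! U hU hbU g hg hgs using h
  refine ⟨fun b => g b b, ?_, fun b hb => hgs b hb b ⟨hb, hbU b hb⟩⟩
  refine contMDiffOn_of_locally_contMDiffOn fun b hb => ⟨U b, hU b hb, hbU b hb, ?_⟩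
  refine (hg b hb).congr fun c hc => ?_
  exact key _ _ (τ c) ((hgs c hc.1 c ⟨hc.1, hbU c hc.1⟩).symm.trans (hgs b hb c hc))

end SmoothMultiple

/-- A smooth principal `ℂˣ`-bundle over a submanifold `S` of the manifold `B`, given by its total
space, the action of `ℂˣ`, whose orbits are the fibres and which is free, and a family of local
sections (equivalently, local trivialisations) with smooth transition functions, which determines
the smooth structure of the total space. Smoothness on a submanifold `S` is `ContMDiffOn`. The
values of a local section outside its domain `e.1 ∩ S` are irrelevant. -/
structure CstarBundle (S : Set B) where
  Tot : Type u
  [action : MulAction ℂˣ Tot]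
  proj : Tot → B
  proj_mem : ∀ p, proj p ∈ S
  proj_smul : ∀ (z : ℂˣ) (p : Tot), proj (z • p) = proj p
  free : ∀ (z : ℂˣ) (p : Tot), z • p = p → z = 1
  transitive : ∀ p q : Tot, proj p = proj q → ∃ z : ℂˣ, p = z • q
  atlas : Set (Set B × (B → Tot))
  isOpen_source : ∀ e ∈ atlas, IsOpen e.1
  proj_section : ∀ e ∈ atlas, ∀ b ∈ e.1 ∩ S, proj (e.2 b) = b
  cover : ∀ b ∈ S, ∃ e ∈ atlas, b ∈ e.1
  transition : ∀ e ∈ atlas, ∀ e' ∈ atlas, SmoothMultiple I (e.1 ∩ e'.1 ∩ S) e.2 e'.2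

attribute [instance] CstarBundle.action

variable {I J}

namespace CstarBundle

variable {S : Set B} (P : CstarBundle I S)

theorem smul_left_injective {z w : ℂˣ} {p : P.Tot} (h : z • p = w • p) : z = w := by
  have : (w⁻¹ * z) • p = p := by rw [mul_smul, h, inv_smul_smul]
  exact (inv_mul_eq_one.mp (P.free _ _ this)).symm

theorem exists_over {b : B} (hb : b ∈ S) : ∃ p : P.Tot, P.proj p = b := by
  obtain ⟨e, he, hbe⟩ := P.cover b hb
  exact ⟨e.2 b, P.proj_section e he b ⟨hbe, hb⟩⟩

/-- `σ` is a smooth section of `P` over the subset `A` of `S`. -/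
def IsSmoothOn (A : Set B) (σ : B → P.Tot) : Prop :=
  (∀ b ∈ A, P.proj (σ b) = b) ∧ ∀ e ∈ P.atlas, SmoothMultiple I (A ∩ e.1) σ e.2

variable {P}

theorem IsSmoothOn.mono {A A' : Set B} {σ : B → P.Tot} (h : P.IsSmoothOn A σ) (hA : A' ⊆ A) :
    P.IsSmoothOn A' σ :=
  ⟨fun b hb => h.1 b (hA hb), fun e he => (h.2 e he).mono (Set.inter_subset_inter_left _ hA)⟩

theorem isSmoothOn_of_local {A : Set B} (hA : A ⊆ S) {σ : B → P.Tot}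
    (h1 : ∀ b ∈ A, P.proj (σ b) = b)
    (h2 : ∀ b ∈ A, ∃ e ∈ P.atlas, ∃ U : Set B, IsOpen U ∧ b ∈ U ∧ U ⊆ e.1 ∧
      SmoothMultiple I (A ∩ U) σ e.2) : P.IsSmoothOn A σ := by
  refine ⟨h1, fun e he => SmoothMultiple.of_local P.free fun b hb => ?_⟩
  obtain ⟨e', he', U, hU, hbU, hUe, h⟩ := h2 b hb.1
  refine ⟨U, hU, hbU, (h.mono ?_).trans ((P.transition e' he' e he).mono ?_)⟩
  · exact fun c hc => ⟨hc.1.1, hc.2⟩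
  · exact fun c hc => ⟨⟨hUe hc.2, hc.1.2⟩, hA hc.1.1⟩

theorem IsSmoothOn.smoothMultiple {A : Set B} (hA : A ⊆ S) {σ τ : B → P.Tot}
    (hσ : P.IsSmoothOn A σ) (hτ : P.IsSmoothOn A τ) : SmoothMultiple I A σ τ := by
  refine SmoothMultiple.of_local P.free fun b hb => ?_
  obtain ⟨e, he, hbe⟩ := P.cover b (hA hb)
  exact ⟨e.1, P.isOpen_source e he, hbe, (hσ.2 e he).trans (hτ.2 e he).symm⟩

variable (P)

/-- A map of `ℂˣ`-bundles covering a map `F` of the bases. -/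
structure HomOver {S' : Set C} (F : B → C) (P : CstarBundle I S) (Q : CstarBundle J S') where
  toFun : P.Tot → Q.Tot
  proj_toFun : ∀ p, Q.proj (toFun p) = F (P.proj p)
  map_smul : ∀ (z : ℂˣ) (p : P.Tot), toFun (z • p) = z • toFun p
  smooth : ∀ e ∈ P.atlas, ∀ e' ∈ Q.atlas,
    SmoothMultiple I (e.1 ∩ F ⁻¹' e'.1 ∩ S) (toFun ∘ e.2) (e'.2 ∘ F)

/-- A map of `ℂˣ`-bundles over `S` covering the identity; it is automatically an isomorphism. -/
abbrev Hom (P Q : CstarBundle I S) := HomOver (id : B → B) P Q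

theorem HomOver.smooth_comp {S' : Set C} {F : B → C} {P : CstarBundle I S} {Q : CstarBundle J S'}
    (φ : HomOver F P Q) {A : Set B} (hA : A ⊆ S) {σ : B → P.Tot} (hσ : P.IsSmoothOn A σ)
    {e : Set C × (C → Q.Tot)} (he : e ∈ Q.atlas) :
    SmoothMultiple I (A ∩ F ⁻¹' e.1) (φ.toFun ∘ σ) (e.2 ∘ F) := by
  refine SmoothMultiple.of_local Q.free fun b hb => ?_
  obtain ⟨e', he', hbe⟩ := P.cover b (hA hb.1)
  refine ⟨e'.1, P.isOpen_source e' he', hbe, ?_⟩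
  obtain ⟨g, hg, h⟩ := hσ.2 e' he'
  have h2 : SmoothMultiple I (A ∩ e'.1) (φ.toFun ∘ σ) (φ.toFun ∘ e'.2) :=
    ⟨g, hg, fun c hc => by simp only [Function.comp, h c hc, φ.map_smul]⟩
  exact (h2.mono fun c hc => ⟨hc.1.1, hc.2⟩).trans
    ((φ.smooth e' he' e he).mono fun c hc => ⟨⟨hc.2, hc.1.2⟩, hA hc.1.1⟩)

theorem isSmoothOn_atlas {e : Set B × (B → P.Tot)} (he : e ∈ P.atlas) :
    P.IsSmoothOn (e.1 ∩ S) e.2 :=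
  ⟨P.proj_section e he, fun e' he' =>
    (P.transition e he e' he').mono fun _ hb => ⟨⟨hb.1.1, hb.2⟩, hb.1.2⟩⟩

/-- The identity map of a bundle. -/
def HomOver.refl (P : CstarBundle I S) : HomOver id P P where
  toFun := id
  proj_toFun _ := rfl
  map_smul _ _ := rfl
  smooth e he e' he' := P.transition e he e' he'

/-- Composition of bundle maps. -/
def HomOver.comp {E₃ : Type u} [NormedAddCommGroup E₃] [NormedSpace ℝ E₃] {H₃ : Type u}
    [TopologicalSpace H₃] {K : ModelWithCorners ℝ E₃ H₃} {D : Type u} [TopologicalSpace D]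
    [ChartedSpace H₃ D] {S' : Set C} {S₃ : Set D} {F : B → C} {G : C → D}
    (hF : ContMDiff I J ∞ F)
    {P : CstarBundle I S} {Q : CstarBundle J S'} {R : CstarBundle K S₃}
    (ψ : HomOver G Q R) (φ : HomOver F P Q) : HomOver (G ∘ F) P R where
  toFun := ψ.toFun ∘ φ.toFun
  proj_toFun p := by simp [ψ.proj_toFun, φ.proj_toFun]
  map_smul z p := by simp [ψ.map_smul, φ.map_smul]
  smooth e he e' he' := by
    refine SmoothMultiple.of_local R.free fun b hb => ?_
    have hFb : F b ∈ S' := by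
      have := Q.proj_mem (φ.toFun (e.2 b))
      rwa [φ.proj_toFun, P.proj_section e he b ⟨hb.1.1, hb.2⟩] at this
    obtain ⟨e₂, he₂, hbe⟩ := Q.cover (F b) hFb
    refine ⟨F ⁻¹' e₂.1, (Q.isOpen_source e₂ he₂).preimage hF.continuous, hbe, ?_⟩
    obtain ⟨g, hg, h⟩ := φ.smooth e he e₂ he₂
    have h1 : SmoothMultiple I (e.1 ∩ F ⁻¹' e₂.1 ∩ S) (ψ.toFun ∘ φ.toFun ∘ e.2)
        (ψ.toFun ∘ e₂.2 ∘ F) :=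
      ⟨g, hg, fun c hc => by
        have := h c hc
        simp only [Function.comp] at this ⊢
        rw [this, ψ.map_smul]⟩
    refine (h1.mono fun c hc => ⟨⟨hc.1.1.1, hc.2⟩, hc.1.2⟩).trans
      ((ψ.smooth e₂ he₂ e' he').comp (F := F) (hF.contMDiffOn) fun c hc => ?_)
    have hFc : F c ∈ S' := by
      have := Q.proj_mem (φ.toFun (e.2 c))
      rwa [φ.proj_toFun, P.proj_section e he c ⟨hc.1.1.1, hc.1.2⟩] at this
    exact ⟨⟨hc.2, hc.1.1.2⟩, hFc⟩

/-- The pullback of a `ℂˣ`-bundle on `S` by a smooth map carrying `A` into `S`: the set of pairs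
`(b, p)` with `F b = proj p`, with the pulled back local sections. -/
def pullback {S' : Set C} (Q : CstarBundle J S') (F : B → C) (hF : ContMDiff I J ∞ F) (A : Set B)
    (hA : Set.MapsTo F A S') : CstarBundle I A where
  Tot := {x : B × Q.Tot // x.1 ∈ A ∧ Q.proj x.2 = F x.1}
  action :=
    { smul := fun z x => ⟨(x.1.1, z • x.1.2), x.2.1, (Q.proj_smul _ _).trans x.2.2⟩
      one_smul := fun x => Subtype.ext (Prod.ext rfl (one_smul _ _))
      mul_smul := fun z w x => Subtype.ext (Prod.ext rfl (mul_smul _ _ _)) }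
  proj x := x.1.1
  proj_mem x := x.2.1
  proj_smul _ _ := rfl
  free z x h := Q.free z x.1.2 (congrArg (fun y => y.1.2) h)
  transitive x y h := by
    obtain ⟨z, hz⟩ := Q.transitive x.1.2 y.1.2 (by rw [x.2.2, y.2.2]; exact congrArg F h)
    exact ⟨z, Subtype.ext (Prod.ext h hz)⟩
  atlas := {e | ∃ e₀ ∈ Q.atlas, e.1 = F ⁻¹' e₀.1 ∧
    ∀ b ∈ e.1 ∩ A, (e.2 b).1.1 = b ∧ (e.2 b).1.2 = e₀.2 (F b)}
  isOpen_source := by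
    rintro e ⟨e₀, he₀, h, -⟩
    exact h ▸ (Q.isOpen_source e₀ he₀).preimage hF.continuous
  proj_section := by
    rintro e ⟨e₀, he₀, h, h'⟩ b hb
    exact (h' b hb).1
  cover b hb := by
    classical
    obtain ⟨e₀, he₀, hbe⟩ := Q.cover (F b) (hA hb)
    let x : ∀ c, c ∈ F ⁻¹' e₀.1 ∩ A → {x : B × Q.Tot // x.1 ∈ A ∧ Q.proj x.2 = F x.1} :=
      fun c hc => ⟨(c, e₀.2 (F c)), hc.2, Q.proj_section e₀ he₀ _ ⟨hc.1, hA hc.2⟩⟩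
    refine ⟨(F ⁻¹' e₀.1, fun c => if hc : c ∈ F ⁻¹' e₀.1 ∩ A then x c hc else x b ⟨hbe, hb⟩),
      ⟨e₀, he₀, rfl, fun c hc => ?_⟩, hbe⟩
    have hc' : c ∈ F ⁻¹' e₀.1 ∩ A := hc
    simp only [dif_pos hc']
    exact ⟨rfl, rfl⟩
  transition := by
    rintro e ⟨e₀, he₀, h, h'⟩ e' ⟨e₀', he₀', k, k'⟩
    obtain ⟨g, hg, hs⟩ := Q.transition e₀ he₀ e₀' he₀'
    have hm : Set.MapsTo F (e.1 ∩ e'.1 ∩ A) (e₀.1 ∩ e₀'.1 ∩ S') := by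
      intro c hc
      rw [h, k] at hc
      exact ⟨hc.1, hA hc.2⟩
    refine ⟨g ∘ F, hg.comp hF.contMDiffOn hm, fun b hb => Subtype.ext (Prod.ext ?_ ?_)⟩
    · exact (h' b ⟨hb.1.1, hb.2⟩).1.trans (k' b ⟨hb.1.2, hb.2⟩).1.symm
    · have := hs (F b) (hm hb)
      rw [← (h' b ⟨hb.1.1, hb.2⟩).2, ← (k' b ⟨hb.1.2, hb.2⟩).2] at this
      exact this

theorem pullback_exists_atlas {S' : Set C} (Q : CstarBundle J S') (F : B → C)
    (hF : ContMDiff I J ∞ F) (A : Set B) (hA : Set.MapsTo F A S') {b : B} (hb : b ∈ A)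
    {e₀ : Set C × (C → Q.Tot)} (he₀ : e₀ ∈ Q.atlas) (hbe : F b ∈ e₀.1) :
    ∃ e ∈ (Q.pullback F hF A hA).atlas, e.1 = F ⁻¹' e₀.1 ∧
      ∀ c ∈ e.1 ∩ A, (e.2 c).1.1 = c ∧ (e.2 c).1.2 = e₀.2 (F c) := by
  classical
  let x : ∀ c, c ∈ F ⁻¹' e₀.1 ∩ A → (Q.pullback F hF A hA).Tot :=
    fun c hc => ⟨(c, e₀.2 (F c)), hc.2, Q.proj_section e₀ he₀ _ ⟨hc.1, hA hc.2⟩⟩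
  have key : ∀ c ∈ F ⁻¹' e₀.1 ∩ A,
      ((fun c => if hc : c ∈ F ⁻¹' e₀.1 ∩ A then x c hc else x b ⟨hbe, hb⟩) c).1.1 = c ∧
      ((fun c => if hc : c ∈ F ⁻¹' e₀.1 ∩ A then x c hc else x b ⟨hbe, hb⟩) c).1.2
        = e₀.2 (F c) := by
    intro c hc
    simp only [dif_pos hc]
    exact ⟨rfl, rfl⟩
  exact ⟨(F ⁻¹' e₀.1, fun c => if hc : c ∈ F ⁻¹' e₀.1 ∩ A then x c hc else x b ⟨hbe, hb⟩),
      ⟨e₀, he₀, rfl, key⟩, rfl, key⟩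

/-- Pairs of points of `P` and `Q` in the same fibre, up to `(z • p, q) ∼ (p, z • q)`. -/
def tensorSetoid (P Q : CstarBundle I S) :
    Setoid {x : P.Tot × Q.Tot // P.proj x.1 = Q.proj x.2} where
  r x y := ∃ z : ℂˣ, y.1.1 = z • x.1.1 ∧ y.1.2 = z⁻¹ • x.1.2
  iseqv :=
    { refl := fun x => ⟨1, by simp⟩
      symm := by
        rintro x y ⟨z, h1, h2⟩
        exact ⟨z⁻¹, by simp [h1], by simp [h2]⟩
      trans := by
        rintro x y w ⟨z, h1, h2⟩ ⟨z', h3, h4⟩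
        exact ⟨z' * z, by rw [h3, h1, mul_smul], by rw [h4, h2, ← mul_smul, mul_inv_rev, mul_comm]⟩ }

/-- The point `p ⊗ q`. -/
def tmk (P Q : CstarBundle I S) (p : P.Tot) (q : Q.Tot) (h : P.proj p = Q.proj q) :
    Quotient (tensorSetoid P Q) :=
  Quotient.mk (tensorSetoid P Q) ⟨(p, q), h⟩

theorem tmk_congr (P Q : CstarBundle I S) {p p' : P.Tot} {q q' : Q.Tot} (h : P.proj p = Q.proj q)
    (hp : p = p') (hq : q = q') :
    tmk P Q p q h = tmk P Q p' q' (by rw [← hp, ← hq]; exact h) := by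
  subst hp; subst hq; rfl

/-- The action of `ℂˣ` on the contracted product. -/
instance tensorAction (P Q : CstarBundle I S) : MulAction ℂˣ (Quotient (tensorSetoid P Q)) where
  smul z := Quotient.map (fun x => ⟨(z • x.1.1, x.1.2), (P.proj_smul _ _).trans x.2⟩) (by
    rintro x y ⟨w, h1, h2⟩
    exact ⟨w, by simp only [h1, smul_comm z w], h2⟩)
  one_smul x := by
    induction x using Quotient.inductionOn with
    | h x => exact congrArg (Quotient.mk _) (Subtype.ext (Prod.ext (one_smul ℂˣ x.1.1) rfl))
  mul_smul z w x := by
    induction x using Quotient.inductionOn with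
    | h x => exact congrArg (Quotient.mk _) (Subtype.ext (Prod.ext (mul_smul z w x.1.1) rfl))

/-- The contracted product `P ⊗ Q` of two `ℂˣ`-bundles over the same base: the quotient of the fibre
product by the antidiagonal subgroup of `ℂˣ × ℂˣ`. -/
def tensor (P Q : CstarBundle I S) : CstarBundle I S where
  Tot := Quotient (tensorSetoid P Q)
  action := tensorAction P Q
  proj := Quotient.lift (fun x => P.proj x.1.1) (by
    rintro x y ⟨w, h1, h2⟩
    simp only [h1, P.proj_smul])
  proj_mem := by rintro ⟨x⟩; exact P.proj_mem _
  proj_smul := by rintro z ⟨x⟩; exact P.proj_smul _ _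
  free := by
    rintro z ⟨x⟩ h
    obtain ⟨w, h1, h2⟩ := Quotient.exact h
    have hw : w⁻¹ = 1 := Q.free w⁻¹ x.1.2 h2.symm
    rw [inv_eq_one] at hw
    subst hw
    rw [one_smul] at h1
    exact P.free z _ h1.symm
  transitive := by
    rintro ⟨x⟩ ⟨y⟩ h
    obtain ⟨z, hz⟩ := P.transitive x.1.1 y.1.1 h
    obtain ⟨w, hw⟩ := Q.transitive x.1.2 y.1.2 (by
      rw [← x.2, ← y.2]; exact h)
    exact ⟨z * w, Quotient.sound ⟨w, by simp only [hz, ← mul_smul, mul_comm], by simp [hw]⟩⟩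
  atlas := {e | ∃ e₁ ∈ P.atlas, ∃ e₂ ∈ Q.atlas, e.1 = e₁.1 ∩ e₂.1 ∧
    ∀ b ∈ e.1 ∩ S, ∃ h, e.2 b = tmk P Q (e₁.2 b) (e₂.2 b) h}
  isOpen_source := by
    rintro e ⟨e₁, he₁, e₂, he₂, h, -⟩
    exact h ▸ (P.isOpen_source e₁ he₁).inter (Q.isOpen_source e₂ he₂)
  proj_section := by
    rintro e ⟨e₁, he₁, e₂, he₂, h, h'⟩ b hb
    obtain ⟨k, hk⟩ := h' b hb
    rw [hk]
    exact P.proj_section e₁ he₁ b ⟨(h ▸ hb.1 : b ∈ e₁.1 ∩ e₂.1).1, hb.2⟩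
  cover b hb := by
    classical
    obtain ⟨e₁, he₁, h₁⟩ := P.cover b hb
    obtain ⟨e₂, he₂, h₂⟩ := Q.cover b hb
    have key : ∀ c, c ∈ (e₁.1 ∩ e₂.1) ∩ S → P.proj (e₁.2 c) = Q.proj (e₂.2 c) := fun c hc => by
      rw [P.proj_section e₁ he₁ c ⟨hc.1.1, hc.2⟩, Q.proj_section e₂ he₂ c ⟨hc.1.2, hc.2⟩]
    refine ⟨(e₁.1 ∩ e₂.1, fun c => if hc : c ∈ (e₁.1 ∩ e₂.1) ∩ S then tmk P Q _ _ (key c hc)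
      else tmk P Q _ _ (key b ⟨⟨h₁, h₂⟩, hb⟩)), ⟨e₁, he₁, e₂, he₂, rfl, fun c hc => ?_⟩, h₁, h₂⟩
    have hc' : c ∈ (e₁.1 ∩ e₂.1) ∩ S := hc
    exact ⟨key c hc', by simp only [dif_pos hc']⟩
  transition := by
    rintro e ⟨e₁, he₁, e₂, he₂, h, h'⟩ k ⟨k₁, hk₁, k₂, hk₂, l, l'⟩
    obtain ⟨g₁, hg₁, hs₁⟩ := P.transition e₁ he₁ k₁ hk₁
    obtain ⟨g₂, hg₂, hs₂⟩ := Q.transition e₂ he₂ k₂ hk₂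
    have m₁ : e.1 ∩ k.1 ∩ S ⊆ e₁.1 ∩ k₁.1 ∩ S := by
      rw [h, l]; exact fun c hc => ⟨⟨hc.1.1.1, hc.1.2.1⟩, hc.2⟩
    have m₂ : e.1 ∩ k.1 ∩ S ⊆ e₂.1 ∩ k₂.1 ∩ S := by
      rw [h, l]; exact fun c hc => ⟨⟨hc.1.1.2, hc.1.2.2⟩, hc.2⟩
    refine ⟨fun b => g₁ b * g₂ b, (hg₁.mono m₁).mul (hg₂.mono m₂), fun b hb => ?_⟩
    obtain ⟨_, h1⟩ := h' b ⟨hb.1.1, hb.2⟩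
    obtain ⟨_, h2⟩ := l' b ⟨hb.1.2, hb.2⟩
    rw [h1, h2]
    refine Quotient.sound ⟨g₂ b, ?_, ?_⟩
    · simp only [hs₁ b (m₁ hb), ← mul_smul, mul_comm]
    · simp only [hs₂ b (m₂ hb), inv_smul_smul]

theorem proj_tmk (P Q : CstarBundle I S) {p : P.Tot} {q : Q.Tot} (h : P.proj p = Q.proj q) :
    (tensor P Q).proj (tmk P Q p q h) = P.proj p := rfl

theorem smul_tmk (P Q : CstarBundle I S) {p : P.Tot} {q : Q.Tot} (h : P.proj p = Q.proj q)
    (z : ℂˣ) : z • tmk P Q p q h = tmk P Q (z • p) q ((P.proj_smul _ _).trans h) := rfl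

theorem tmk_smul (P Q : CstarBundle I S) {p : P.Tot} {q : Q.Tot} (h : P.proj p = Q.proj q)
    (z : ℂˣ) (h' : P.proj p = Q.proj (z • q)) :
    tmk P Q p (z • q) h' = z • tmk P Q p q h := by
  rw [smul_tmk]
  exact Quotient.sound ⟨z, rfl, by simp⟩

theorem tensor_exists_atlas (P Q : CstarBundle I S) {b : B} (hb : b ∈ S)
    {e₁ : Set B × (B → P.Tot)} (he₁ : e₁ ∈ P.atlas) (h₁ : b ∈ e₁.1)
    {e₂ : Set B × (B → Q.Tot)} (he₂ : e₂ ∈ Q.atlas) (h₂ : b ∈ e₂.1) :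
    ∃ e ∈ (tensor P Q).atlas, e.1 = e₁.1 ∩ e₂.1 ∧
      ∀ c ∈ e.1 ∩ S, ∃ h, e.2 c = tmk P Q (e₁.2 c) (e₂.2 c) h := by
  classical
  have key : ∀ c, c ∈ (e₁.1 ∩ e₂.1) ∩ S → P.proj (e₁.2 c) = Q.proj (e₂.2 c) := fun c hc => by
    rw [P.proj_section e₁ he₁ c ⟨hc.1.1, hc.2⟩, Q.proj_section e₂ he₂ c ⟨hc.1.2, hc.2⟩]
  have key' : ∀ c ∈ (e₁.1 ∩ e₂.1) ∩ S, ∃ h,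
      (if hc : c ∈ (e₁.1 ∩ e₂.1) ∩ S then tmk P Q _ _ (key c hc)
      else tmk P Q _ _ (key b ⟨⟨h₁, h₂⟩, hb⟩)) = tmk P Q (e₁.2 c) (e₂.2 c) h := fun c hc =>
    ⟨key c hc, by simp only [dif_pos hc]⟩
  exact ⟨(e₁.1 ∩ e₂.1, fun c => if hc : c ∈ (e₁.1 ∩ e₂.1) ∩ S then tmk P Q _ _ (key c hc)
      else tmk P Q _ _ (key b ⟨⟨h₁, h₂⟩, hb⟩)), ⟨e₁, he₁, e₂, he₂, rfl, key'⟩, rfl, key'⟩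

end CstarBundle

/-- A smooth global section of a `ℂˣ`-bundle on the manifold `B`. -/
@[ext]
structure GlobalSection (P : CstarBundle I (Set.univ : Set B)) where
  toFun : B → P.Tot
  smooth : P.IsSmoothOn Set.univ toFun

namespace GlobalSection

variable {P Q : CstarBundle I (Set.univ : Set B)}

theorem proj_toFun (σ : GlobalSection P) (b : B) : P.proj (σ.toFun b) = b :=
  σ.smooth.1 b (Set.mem_univ b)

/-- The tensor product `σ ⊗ τ` of two sections. -/
def tensor (σ : GlobalSection P) (τ : GlobalSection Q) : GlobalSection (P.tensor Q) where
  toFun b := CstarBundle.tmk P Q (σ.toFun b) (τ.toFun b) (by rw [σ.proj_toFun, τ.proj_toFun])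
  smooth := by
    refine ⟨fun b _ => σ.proj_toFun b, ?_⟩
    rintro e ⟨e₁, he₁, e₂, he₂, h, h'⟩
    obtain ⟨g₁, hg₁, hs₁⟩ := σ.smooth.2 e₁ he₁
    obtain ⟨g₂, hg₂, hs₂⟩ := τ.smooth.2 e₂ he₂
    have m₁ : Set.univ ∩ e.1 ⊆ Set.univ ∩ e₁.1 := by rw [h]; exact fun c hc => ⟨hc.1, hc.2.1⟩
    have m₂ : Set.univ ∩ e.1 ⊆ Set.univ ∩ e₂.1 := by rw [h]; exact fun c hc => ⟨hc.1, hc.2.2⟩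
    refine ⟨fun b => g₁ b * g₂ b, (hg₁.mono m₁).mul (hg₂.mono m₂), fun b hb => ?_⟩
    obtain ⟨_, h1⟩ := h' b ⟨hb.2, hb.1⟩
    rw [h1]
    refine Quotient.sound ⟨g₂ b, ?_, ?_⟩
    · simp only [hs₁ b (m₁ hb), ← mul_smul, mul_comm]
    · simp only [hs₂ b (m₂ hb), inv_smul_smul]

/-- The image of a section under a bundle map. -/
def map (φ : CstarBundle.Hom P Q) (σ : GlobalSection P) : GlobalSection Q where
  toFun b := φ.toFun (σ.toFun b)
  smooth := ⟨fun b _ => by rw [φ.proj_toFun, σ.proj_toFun]; rfl,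
    fun _ he => φ.smooth_comp (Set.subset_univ _) σ.smooth he⟩

end GlobalSection

end Bundles

section Descent

set_option linter.unusedSectionVars false

variable {E : Type u} [NormedAddCommGroup E] [NormedSpace ℝ E] {H : Type u} [TopologicalSpace H]
  {I : ModelWithCorners ℝ E H} {X : Type u} [TopologicalSpace X] [ChartedSpace H X]
  {E' : Type u} [NormedAddCommGroup E'] [NormedSpace ℝ E'] {H' : Type u} [TopologicalSpace H']
  {J : ModelWithCorners ℝ E' H'} {M : Type u} [TopologicalSpace M] [ChartedSpace H' M]

/-- The fibre product `X^[2]`, as a subset of `X × X`. -/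
def fib2 (π : X → M) : Set (X × X) := {z | π z.1 = π z.2}

/-- The triple fibre product `X^[3]`, as a subset of `X × X × X`. -/
def fib3 (π : X → M) : Set (X × X × X) := {z | π z.1 = π z.2.1 ∧ π z.2.1 = π z.2.2}

variable (I J) in
/-- `π` is a surjection admitting smooth local sections: they exist near every point of `M`. -/
def HasLocalSections (π : X → M) : Prop :=
  ∀ m : M, ∃ U : Set M, IsOpen U ∧ m ∈ U ∧ ∃ s : M → X, ContMDiffOn J I ∞ s U ∧
    ∀ y ∈ U, π (s y) = y

theorem HasLocalSections.surjective {π : X → M} (h : HasLocalSections I J π) :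
    Function.Surjective π := fun m => by
  obtain ⟨U, -, hm, s, -, hs⟩ := h m
  exact ⟨s m, hs m hm⟩

namespace CstarBundle

/-- The value on `p`, a point over `x₂`, of a map `π₁⁻¹P → π₂⁻¹P` over the point `(x, x₂)`. (The
projection `π₁ : X^[2] → X` omits the first point, and `π₂` omits the second.) -/
def descentApp {π : X → M} {P : CstarBundle I (Set.univ : Set X)}
    (φ : Hom (P.pullback Prod.snd contMDiff_snd (fib2 π) (Set.mapsTo_univ _ _))
      (P.pullback Prod.fst contMDiff_fst (fib2 π) (Set.mapsTo_univ _ _)))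
    (x : X) (p : P.Tot) (h : π x = π (P.proj p)) : P.Tot :=
  (φ.toFun ⟨((x, P.proj p), p), h, rfl⟩).1.2

theorem proj_descentApp {π : X → M} {P : CstarBundle I (Set.univ : Set X)}
    (φ : Hom (P.pullback Prod.snd contMDiff_snd (fib2 π) (Set.mapsTo_univ _ _))
      (P.pullback Prod.fst contMDiff_fst (fib2 π) (Set.mapsTo_univ _ _)))
    (x : X) (p : P.Tot) (h : π x = π (P.proj p)) : P.proj (descentApp φ x p h) = x :=
  (φ.toFun ⟨((x, P.proj p), p), h, rfl⟩).2.2.trans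
    (congrArg Prod.fst (φ.proj_toFun ⟨((x, P.proj p), p), h, rfl⟩))

/-- A descent isomorphism `φ : π₁⁻¹P → π₂⁻¹P` over `X^[2]`, satisfying the gluing law
`π₃⁻¹φ ∘ π₁⁻¹φ = π₂⁻¹φ` over `X^[3]`. -/
structure DescentIso (π : X → M) (P : CstarBundle I (Set.univ : Set X)) where
  φ : Hom (P.pullback Prod.snd contMDiff_snd (fib2 π) (Set.mapsTo_univ _ _))
    (P.pullback Prod.fst contMDiff_fst (fib2 π) (Set.mapsTo_univ _ _))
  gluing : ∀ (x₁ x₂ : X) (p : P.Tot) (h₁₂ : π x₁ = π x₂) (h₂₃ : π x₂ = π (P.proj p)),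
    descentApp φ x₁ (descentApp φ x₂ p h₂₃) (h₁₂.trans (by rw [proj_descentApp])) =
      descentApp φ x₁ p (h₁₂.trans h₂₃)

variable {π : X → M} {P : CstarBundle I (Set.univ : Set X)}

/-- A point over `m` of the descended bundle: a family of points of `P`, one over each point of
`π⁻¹(m)`, matched by the descent isomorphism. -/
structure DescendTot (d : DescentIso π P) where
  base : M
  val : {x : X // π x = base} → P.Tot
  proj_val : ∀ x, P.proj (val x) = x.1
  compat : ∀ x₁ x₂ : {x : X // π x = base},
    descentApp d.φ x₁.1 (val x₂) (by rw [proj_val, x₁.2, x₂.2]) = val x₁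

variable {d : DescentIso π P}

theorem DescendTot.ext {a b : DescendTot d} (h : a.base = b.base)
    (hv : ∀ (x : X) (ha : π x = a.base) (hb : π x = b.base), a.val ⟨x, ha⟩ = b.val ⟨x, hb⟩) :
    a = b := by
  obtain ⟨m, v, h1, h2⟩ := a
  obtain ⟨m', v', h1', h2'⟩ := b
  subst h
  have : v = v' := funext fun x => hv x.1 x.2 x.2
  subst this
  rfl

theorem descentApp_smul
    (φ : Hom (P.pullback Prod.snd contMDiff_snd (fib2 π) (Set.mapsTo_univ _ _))
      (P.pullback Prod.fst contMDiff_fst (fib2 π) (Set.mapsTo_univ _ _)))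
    (x : X) (z : ℂˣ) (p : P.Tot) (h : π x = π (P.proj (z • p))) :
    descentApp φ x (z • p) h = z • descentApp φ x p (by rwa [P.proj_smul] at h) := by
  have h' : π x = π (P.proj p) := by rwa [P.proj_smul] at h
  let a : (P.pullback (I := I.prod I) Prod.snd contMDiff_snd (fib2 π) (Set.mapsTo_univ _ _)).Tot :=
    ⟨((x, P.proj p), p), h', rfl⟩
  have e : (⟨((x, P.proj (z • p)), z • p), h, rfl⟩ :
      (P.pullback (I := I.prod I) Prod.snd contMDiff_snd (fib2 π) (Set.mapsTo_univ _ _)).Tot) =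
      z • a :=
    Subtype.ext (Prod.ext (Prod.ext rfl (P.proj_smul z p)) rfl)
  exact (congrArg (fun w => (φ.toFun w).1.2) e).trans
    (congrArg (fun w => w.1.2) (φ.map_smul z a))

theorem descentApp_congr
    (φ : Hom (P.pullback Prod.snd contMDiff_snd (fib2 π) (Set.mapsTo_univ _ _))
      (P.pullback Prod.fst contMDiff_fst (fib2 π) (Set.mapsTo_univ _ _)))
    {x x' : X} {p p' : P.Tot} (hx : x = x') (hp : p = p') (h : π x = π (P.proj p)) :
    descentApp φ x p h = descentApp φ x' p' (by rw [← hx, ← hp]; exact h) := by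
  subst hx; subst hp; rfl

theorem DescendTot.val_congr {a b : DescendTot d} (h : a = b) (x : X) (ha : π x = a.base)
    (hb : π x = b.base) : a.val ⟨x, ha⟩ = b.val ⟨x, hb⟩ := by
  subst h; rfl

instance DescendTot.action (d : DescentIso π P) : MulAction ℂˣ (DescendTot d) where
  smul z a :=
    { base := a.base
      val := fun x => z • a.val x
      proj_val := fun x => (P.proj_smul _ _).trans (a.proj_val x)
      compat := fun x₁ x₂ => by rw [descentApp_smul, a.compat] }
  one_smul a := DescendTot.ext rfl fun _ _ _ => one_smul _ _
  mul_smul z w a := DescendTot.ext rfl fun _ _ _ => mul_smul _ _ _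

/-- The smooth local sections of the descended bundle are those whose lift to `X`,
`x ↦ e.2 (π x)` evaluated at `x`, is a smooth section of `P`. -/
def DescendTot.atlas (d : DescentIso π P) : Set (Set M × (M → DescendTot d)) :=
  {e | IsOpen e.1 ∧ (∀ m ∈ e.1, (e.2 m).base = m) ∧ ∃ l : X → P.Tot,
    (∀ (x : X) (_ : π x ∈ e.1) (h : π x = (e.2 (π x)).base), l x = (e.2 (π x)).val ⟨x, h⟩) ∧
    P.IsSmoothOn (π ⁻¹' e.1) l}

theorem DescendTot.exists_atlas (hπ : ContMDiff I J ∞ π) (hs : HasLocalSections I J π) (m : M) :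
    ∃ e ∈ DescendTot.atlas d, m ∈ e.1 := by
  classical
  obtain ⟨U, hU, hmU, s, hsU, hsπ⟩ := hs m
  obtain ⟨e₀, he₀, hme⟩ := P.cover (s m) (Set.mem_univ _)
  have hV : IsOpen (U ∩ s ⁻¹' e₀.1) :=
    hsU.continuousOn.isOpen_inter_preimage hU (P.isOpen_source e₀ he₀)
  set V := U ∩ s ⁻¹' e₀.1 with hVdef
  have hp : ∀ y ∈ V, P.proj (e₀.2 (s y)) = s y := fun y hy =>
    P.proj_section e₀ he₀ _ ⟨hy.2, Set.mem_univ _⟩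
  have hpπ : ∀ y ∈ V, π (P.proj (e₀.2 (s y))) = y := fun y hy => by rw [hp y hy, hsπ y hy.1]
  let σ : ∀ y, y ∈ V → DescendTot d := fun y hy =>
    { base := y
      val := fun x => descentApp d.φ x.1 (e₀.2 (s y)) (by rw [hpπ y hy]; exact x.2)
      proj_val := fun x => proj_descentApp _ _ _ _
      compat := fun x₁ x₂ => d.gluing x₁.1 x₂.1 _ (x₁.2.trans x₂.2.symm) _ }
  have hmV : m ∈ V := ⟨hmU, hme⟩
  let l : X → P.Tot := fun x => if hx : π x ∈ V then
      descentApp d.φ x (e₀.2 (s (π x))) (hpπ _ hx).symm else e₀.2 (s m)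
  have hl : ∀ x (hx : π x ∈ V), l x = descentApp d.φ x (e₀.2 (s (π x))) (hpπ _ hx).symm :=
    fun x hx => dif_pos hx
  refine ⟨(V, fun y => if hy : y ∈ V then σ y hy else σ m hmV), ⟨hV, ?_, l, ?_, ?_⟩, hmV⟩
  · intro y hy
    simp only [dif_pos hy]
    rfl
  · intro x hx h
    have hx' : π x ∈ V := hx
    rw [hl x hx']
    have hσ : (if hy : π x ∈ V then σ (π x) hy else σ m hmV) = σ (π x) hx' := dif_pos hx'
    exact (DescendTot.val_congr hσ x h rfl).symm
  · refine isSmoothOn_of_local (Set.subset_univ _) ?_ ?_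
    · intro x hx
      rw [hl x hx]
      exact proj_descentApp _ _ _ _
    · intro x hx
      obtain ⟨e₁, he₁, hxe⟩ := P.cover x (Set.mem_univ _)
      have hmem : (x, s (π x)) ∈ fib2 π := (hsπ _ hx.1).symm
      obtain ⟨k₀, hk₀, hk₀U, hk₀s⟩ := P.pullback_exists_atlas (I := I.prod I) (Prod.snd : X × X → X)
        contMDiff_snd (fib2 π) (Set.mapsTo_univ _ _) hmem he₀ hx.2
      obtain ⟨k₁, hk₁, hk₁U, hk₁s⟩ := P.pullback_exists_atlas (I := I.prod I) (Prod.fst : X × X → X)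
        contMDiff_fst (fib2 π) (Set.mapsTo_univ _ _) hmem he₁ hxe
      have hsm := d.φ.smooth k₀ hk₀ k₁ hk₁
      obtain ⟨g, hg, hgs⟩ := hsm
      refine ⟨e₁, he₁, e₁.1, P.isOpen_source e₁ he₁, hxe, subset_rfl,
        fun x => g (x, s (π x)), hg.comp (t := k₀.1 ∩ id ⁻¹' k₁.1 ∩ fib2 π)
          (f := fun x => (x, s (π x))) ?_ ?_, ?_⟩
      · refine contMDiffOn_id.prodMk (hsU.comp hπ.contMDiffOn ?_)
        exact fun y hy => hy.1.1
      · intro y hy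
        refine ⟨⟨?_, ?_⟩, (hsπ _ hy.1.1).symm⟩
        · rw [hk₀U]; exact hy.1.2
        · change _ ∈ k₁.1
          rw [hk₁U]; exact hy.2
      · intro y hy
        have hy2 : (y, s (π y)) ∈ fib2 π := (hsπ _ hy.1.1).symm
        have hy0 : (y, s (π y)) ∈ k₀.1 := by rw [hk₀U]; exact hy.1.2
        have hy1 : (y, s (π y)) ∈ k₁.1 := by rw [hk₁U]; exact hy.2
        have h1 := hgs (y, s (π y)) ⟨⟨hy0, hy1⟩, hy2⟩
        obtain ⟨h2, h3⟩ := hk₀s _ ⟨hy0, hy2⟩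
        obtain ⟨h4, h5⟩ := hk₁s _ ⟨hy1, hy2⟩
        have h6 : k₀.2 (y, s (π y)) = ⟨((y, P.proj (e₀.2 (s (π y)))), e₀.2 (s (π y))),
            (hpπ _ hy.1).symm, rfl⟩ := by
          refine Subtype.ext (Prod.ext (h2.trans ?_) h3)
          exact Prod.ext rfl (hp _ hy.1).symm
        have h7 := congrArg (fun w => w.1.2) h1
        simp only [Function.comp, h6] at h7
        rw [hl y hy.1]
        refine h7.trans ?_
        change g (y, s (π y)) • (k₁.2 (y, s (π y))).1.2 = _
        rw [h5]

theorem DescendTot.transitive (hs : Function.Surjective π) (a b : DescendTot d)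
    (h : a.base = b.base) : ∃ z : ℂˣ, a = z • b := by
  obtain ⟨x, hx⟩ := hs a.base
  obtain ⟨z, hz⟩ := P.transitive (a.val ⟨x, hx⟩) (b.val ⟨x, hx.trans h⟩)
    (by rw [a.proj_val, b.proj_val])
  refine ⟨z, DescendTot.ext h fun y ha hb => ?_⟩
  rw [← a.compat ⟨y, ha⟩ ⟨x, hx⟩, descentApp_congr d.φ rfl hz, descentApp_smul,
    b.compat ⟨y, ha.trans h⟩ ⟨x, hx.trans h⟩]
  rfl

theorem DescendTot.transition (hs : HasLocalSections I J π)
    {e e' : Set M × (M → DescendTot d)}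
    (he : e ∈ DescendTot.atlas d) (he' : e' ∈ DescendTot.atlas d) :
    SmoothMultiple J (e.1 ∩ e'.1 ∩ Set.univ) e.2 e'.2 := by
  obtain ⟨ho, hb, l, hl, hls⟩ := he
  obtain ⟨ho', hb', l', hl', hls'⟩ := he'
  have h1 : ∀ m ∈ e.1 ∩ e'.1 ∩ Set.univ, ∃ z : ℂˣ, e.2 m = z • e'.2 m := fun m hm =>
    DescendTot.transitive hs.surjective _ _ (by rw [hb m hm.1.1, hb' m hm.1.2])
  choose! g hg using h1
  refine ⟨g, contMDiffOn_of_locally_contMDiffOn fun m hm => ?_, hg⟩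
  obtain ⟨U, hU, hmU, s, hsU, hsπ⟩ := hs m
  obtain ⟨k, hk, hks⟩ := ((hls.mono (A' := π ⁻¹' (e.1 ∩ e'.1)) fun x hx => hx.1).smoothMultiple
    (Set.subset_univ _) (hls'.mono fun x hx => hx.2))
  have hmaps : Set.MapsTo s (e.1 ∩ e'.1 ∩ Set.univ ∩ U) (π ⁻¹' (e.1 ∩ e'.1)) := fun y hy => by
    change π (s y) ∈ e.1 ∩ e'.1
    rw [hsπ y hy.2]; exact hy.1.1
  refine ⟨U, hU, hmU, (hk.comp (hsU.mono fun y hy => hy.2) hmaps).congr fun y hy => ?_⟩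
  have hy1 : π (s y) ∈ e.1 ∩ e'.1 := hmaps hy
  have hsy : π (s y) = y := hsπ y hy.2
  have h2 := hks (s y) hy1
  rw [hl (s y) hy1.1 (hb _ hy1.1).symm, hl' (s y) hy1.2 (hb' _ hy1.2).symm] at h2
  have h3 := hg (π (s y)) ⟨hy1, Set.mem_univ _⟩
  have h4 : (e.2 (π (s y))).val ⟨s y, (hb _ hy1.1).symm⟩ =
      g (π (s y)) • (e'.2 (π (s y))).val ⟨s y, (hb' _ hy1.2).symm⟩ :=
    DescendTot.val_congr h3 (s y) _ (hb' _ hy1.2).symm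
  rw [h4] at h2
  have h5 := P.smul_left_injective h2
  rw [hsy] at h5
  exact h5

/-- The `ℂˣ`-bundle on `M` obtained by descent. -/
def descend (hπ : ContMDiff I J ∞ π) (hs : HasLocalSections I J π) (d : DescentIso π P) :
    CstarBundle J (Set.univ : Set M) where
  Tot := DescendTot d
  proj := DescendTot.base
  proj_mem _ := Set.mem_univ _
  proj_smul _ _ := rfl
  free z a h := by
    obtain ⟨x, hx⟩ := hs.surjective a.base
    exact P.free z (a.val ⟨x, hx⟩) (DescendTot.val_congr h x hx hx)
  transitive := DescendTot.transitive hs.surjective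
  atlas := DescendTot.atlas d
  isOpen_source _ he := he.1
  proj_section _ he b hb := he.2.1 b hb.1
  cover m _ := DescendTot.exists_atlas hπ hs m
  transition _ he _ he' := DescendTot.transition hs he he'

end CstarBundle
end Descent

noncomputable section Product

set_option linter.unusedSectionVars false

open CstarBundle

variable {E : Type u} [NormedAddCommGroup E] [NormedSpace ℝ E] {H : Type u} [TopologicalSpace H]
  {I : ModelWithCorners ℝ E H} {X : Type u} [TopologicalSpace X] [ChartedSpace H X] {M : Type u}

/-- The projection `X^[3] → X^[2]` omitting the first point. -/
def face₁ (z : X × X × X) : X × X := (z.2.1, z.2.2)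

/-- The projection `X^[3] → X^[2]` omitting the second point. -/
def face₂ (z : X × X × X) : X × X := (z.1, z.2.2)

/-- The projection `X^[3] → X^[2]` omitting the third point. -/
def face₃ (z : X × X × X) : X × X := (z.1, z.2.1)

theorem contMDiff_face₁ : ContMDiff (I.prod (I.prod I)) (I.prod I) ∞ (face₁ : X × X × X → X × X) :=
  contMDiff_snd.fst.prodMk contMDiff_snd.snd

theorem contMDiff_face₂ : ContMDiff (I.prod (I.prod I)) (I.prod I) ∞ (face₂ : X × X × X → X × X) :=
  contMDiff_fst.prodMk contMDiff_snd.snd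

theorem contMDiff_face₃ : ContMDiff (I.prod (I.prod I)) (I.prod I) ∞ (face₃ : X × X × X → X × X) :=
  contMDiff_fst.prodMk contMDiff_snd.fst

theorem mapsTo_face₁ (π : X → M) : Set.MapsTo face₁ (fib3 π) (fib2 π) := fun _ h => h.2

theorem mapsTo_face₂ (π : X → M) : Set.MapsTo face₂ (fib3 π) (fib2 π) := fun _ h => h.1.trans h.2

theorem mapsTo_face₃ (π : X → M) : Set.MapsTo face₃ (fib3 π) (fib2 π) := fun _ h => h.1

variable {π : X → M}

/-- An isomorphism `π₁⁻¹P ⊗ π₃⁻¹P → π₂⁻¹P` of `ℂˣ`-bundles over `X^[3]`. -/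
abbrev ProductMap (P : CstarBundle (I.prod I) (fib2 π)) :=
  Hom ((P.pullback (I := I.prod (I.prod I)) face₁ contMDiff_face₁ (fib3 π) (mapsTo_face₁ π)).tensor
      (P.pullback face₃ contMDiff_face₃ (fib3 π) (mapsTo_face₃ π)))
    (P.pullback face₂ contMDiff_face₂ (fib3 π) (mapsTo_face₂ π))

variable {P : CstarBundle (I.prod I) (fib2 π)} (m : ProductMap P)

/-- For `u` over `(x₂, x₃)` and `v` over `(x₁, x₂)` the point `m(u ⊗ v)` over `(x₁, x₃)`. -/
def ProductMap.app (u v : P.Tot) (h : (P.proj u).1 = (P.proj v).2) : P.Tot :=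
  (m.toFun (tmk _ _
    ⟨(((P.proj v).1, (P.proj v).2, (P.proj u).2), u),
      ⟨P.proj_mem v, by rw [← h]; exact P.proj_mem u⟩, by rw [face₁, ← h]⟩
    ⟨(((P.proj v).1, (P.proj v).2, (P.proj u).2), v),
      ⟨P.proj_mem v, by rw [← h]; exact P.proj_mem u⟩, rfl⟩ rfl)).1.2

theorem ProductMap.app_eq (z : X × X × X) (hz : z ∈ fib3 π) (u v : P.Tot)
    (hu : P.proj u = face₁ z) (hv : P.proj v = face₃ z) (h : (P.proj u).1 = (P.proj v).2) (k) :
    ProductMap.app m u v h = (m.toFun (tmk _ _ ⟨(z, u), hz, hu⟩ ⟨(z, v), hz, hv⟩ k)).1.2 := by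
  have : z = ((P.proj v).1, (P.proj v).2, (P.proj u).2) := by
    rw [hu, hv]; rfl
  subst this
  rfl

theorem ProductMap.proj_app (u v : P.Tot) (h : (P.proj u).1 = (P.proj v).2) :
    P.proj (ProductMap.app m u v h) = ((P.proj v).1, (P.proj u).2) := by
  exact (m.toFun _).2.2.trans (congrArg face₂ (m.proj_toFun _))

theorem ProductMap.smul_app (z : ℂˣ) (u v : P.Tot) (h : (P.proj (z • u)).1 = (P.proj v).2) :
    ProductMap.app m (z • u) v h =
      z • ProductMap.app m u v (by rwa [P.proj_smul] at h) := by
  have h' : (P.proj u).1 = (P.proj v).2 := by rwa [P.proj_smul] at h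
  have hz : ((P.proj v).1, (P.proj v).2, (P.proj u).2) ∈ fib3 π :=
    ⟨P.proj_mem v, by rw [← h']; exact P.proj_mem u⟩
  have hu : P.proj u = face₁ ((P.proj v).1, (P.proj v).2, (P.proj u).2) := by rw [face₁, ← h']
  rw [ProductMap.app_eq m _ hz (z • u) v ((P.proj_smul _ _).trans hu) rfl h rfl,
    ProductMap.app_eq m _ hz u v hu rfl h' rfl]
  let a : (P.pullback (I := I.prod (I.prod I)) face₁ contMDiff_face₁ (fib3 π)
    (mapsTo_face₁ π)).Tot := ⟨(((P.proj v).1, (P.proj v).2, (P.proj u).2), u), hz, hu⟩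
  let b : (P.pullback (I := I.prod (I.prod I)) face₃ contMDiff_face₃ (fib3 π)
    (mapsTo_face₃ π)).Tot := ⟨(((P.proj v).1, (P.proj v).2, (P.proj u).2), v), hz, rfl⟩
  exact congrArg (fun w => w.1.2) (m.map_smul z (tmk _ _ a b rfl))

theorem ProductMap.app_smul (z : ℂˣ) (u v : P.Tot) (h : (P.proj u).1 = (P.proj (z • v)).2) :
    ProductMap.app m u (z • v) h =
      z • ProductMap.app m u v (by rwa [P.proj_smul] at h) := by
  have h' : (P.proj u).1 = (P.proj v).2 := by rwa [P.proj_smul] at h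
  have hz : ((P.proj v).1, (P.proj v).2, (P.proj u).2) ∈ fib3 π :=
    ⟨P.proj_mem v, by rw [← h']; exact P.proj_mem u⟩
  have hu : P.proj u = face₁ ((P.proj v).1, (P.proj v).2, (P.proj u).2) := by rw [face₁, ← h']
  rw [ProductMap.app_eq m _ hz u (z • v) hu (P.proj_smul _ _) h rfl,
    ProductMap.app_eq m _ hz u v hu rfl h' rfl]
  let a : (P.pullback (I := I.prod (I.prod I)) face₁ contMDiff_face₁ (fib3 π)
    (mapsTo_face₁ π)).Tot := ⟨(((P.proj v).1, (P.proj v).2, (P.proj u).2), u), hz, hu⟩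
  let b : (P.pullback (I := I.prod (I.prod I)) face₃ contMDiff_face₃ (fib3 π)
    (mapsTo_face₃ π)).Tot := ⟨(((P.proj v).1, (P.proj v).2, (P.proj u).2), v), hz, rfl⟩
  have e := tmk_smul _ _ (p := a) (q := b) rfl z rfl
  exact (congrArg (fun w => (m.toFun w).1.2) e).trans
    (congrArg (fun w => w.1.2) (m.map_smul z (tmk _ _ a b rfl)))

theorem ProductMap.smooth {e₁ e₂ e₃ : Set (X × X) × (X × X → P.Tot)} (he₁ : e₁ ∈ P.atlas)
    (he₂ : e₂ ∈ P.atlas) (he₃ : e₃ ∈ P.atlas) {A : Set (X × X × X)} (hA : A ⊆ fib3 π)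
    (h₁ : ∀ z ∈ A, face₁ z ∈ e₁.1) (h₂ : ∀ z ∈ A, face₂ z ∈ e₂.1) (h₃ : ∀ z ∈ A, face₃ z ∈ e₃.1) :
    ∃ g : X × X × X → ℂˣ, ContMDiffOn (I.prod (I.prod I)) 𝓘(ℝ, ℂ) ∞ g A ∧
      ∀ z ∈ A, ∀ h, ProductMap.app m (e₁.2 (face₁ z)) (e₃.2 (face₃ z)) h = g z • e₂.2 (face₂ z) := by
  rcases A.eq_empty_or_nonempty with rfl | ⟨b, hb⟩
  · exact ⟨fun _ => 1, contMDiffOn_const, fun z hz => hz.elim⟩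
  obtain ⟨k₁, hk₁, U₁, s₁⟩ := P.pullback_exists_atlas (I := I.prod (I.prod I)) face₁ contMDiff_face₁
    (fib3 π) (mapsTo_face₁ π) (hA hb) he₁ (h₁ b hb)
  obtain ⟨k₂, hk₂, U₂, s₂⟩ := P.pullback_exists_atlas (I := I.prod (I.prod I)) face₂ contMDiff_face₂
    (fib3 π) (mapsTo_face₂ π) (hA hb) he₂ (h₂ b hb)
  obtain ⟨k₃, hk₃, U₃, s₃⟩ := P.pullback_exists_atlas (I := I.prod (I.prod I)) face₃ contMDiff_face₃
    (fib3 π) (mapsTo_face₃ π) (hA hb) he₃ (h₃ b hb)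
  obtain ⟨k, hk, U, s⟩ := tensor_exists_atlas _ _ (hA hb) hk₁ (by rw [U₁]; exact h₁ b hb)
    hk₃ (by rw [U₃]; exact h₃ b hb)
  obtain ⟨g, hg, hgs⟩ := HomOver.smooth m k hk k₂ hk₂
  have hsub : A ⊆ k.1 ∩ id ⁻¹' k₂.1 ∩ fib3 π := fun z hz =>
    ⟨⟨by rw [U, U₁, U₃]; exact ⟨h₁ z hz, h₃ z hz⟩, by
      change z ∈ k₂.1
      rw [U₂]; exact h₂ z hz⟩, hA hz⟩
  refine ⟨g, hg.mono hsub, fun z hz h => ?_⟩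
  have q := hgs z (hsub hz)
  obtain ⟨_, q'⟩ := s z ⟨(hsub hz).1.1, hA hz⟩
  obtain ⟨a₁, a₂⟩ := s₁ z ⟨by rw [U₁]; exact h₁ z hz, hA hz⟩
  obtain ⟨b₁, b₂⟩ := s₃ z ⟨by rw [U₃]; exact h₃ z hz, hA hz⟩
  obtain ⟨c₁, c₂⟩ := s₂ z ⟨by rw [U₂]; exact h₂ z hz, hA hz⟩
  have p₁ : P.proj (e₁.2 (face₁ z)) = face₁ z :=
    P.proj_section e₁ he₁ _ ⟨h₁ z hz, mapsTo_face₁ π (hA hz)⟩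
  have p₃ : P.proj (e₃.2 (face₃ z)) = face₃ z :=
    P.proj_section e₃ he₃ _ ⟨h₃ z hz, mapsTo_face₃ π (hA hz)⟩
  rw [ProductMap.app_eq m z (hA hz) _ _ p₁ p₃ h rfl, ← c₂]
  let x₁ : (P.pullback (I := I.prod (I.prod I)) face₁ contMDiff_face₁ (fib3 π)
    (mapsTo_face₁ π)).Tot := ⟨(z, e₁.2 (face₁ z)), hA hz, p₁⟩
  let x₃ : (P.pullback (I := I.prod (I.prod I)) face₃ contMDiff_face₃ (fib3 π)
    (mapsTo_face₃ π)).Tot := ⟨(z, e₃.2 (face₃ z)), hA hz, p₃⟩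
  have r₁ : k₁.2 z = x₁ := Subtype.ext (Prod.ext a₁ a₂)
  have r₃ : k₃.2 z = x₃ := Subtype.ext (Prod.ext b₁ b₂)
  have r : k.2 z = tmk _ _ x₁ x₃ rfl := q'.trans (tmk_congr _ _ _ r₁ r₃)
  have t := congrArg (fun w => w.1.2) q
  have t' := congrArg (fun w => (m.toFun w).1.2) r
  exact t'.symm.trans t

end Product

noncomputable section Gerbe

open CstarBundle

/-- A bundle gerbe `(P, X, M)` on the manifold `M`: a smooth surjection `π : X → M` admitting local
sections (such that the fibre products `X^[2]` and `X^[3]` are manifolds), a principal `ℂˣ`-bundle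
`P → X^[2]` and an associative product `m : π₁⁻¹P ⊗ π₃⁻¹P → π₂⁻¹P` over `X^[3]`. -/
structure BundleGerbe (EM : Type u) [NormedAddCommGroup EM] [NormedSpace ℝ EM] (M : Type u)
    [TopologicalSpace M] [ChartedSpace EM M] where
  E : Type u
  [normE : NormedAddCommGroup E]
  [spaceE : NormedSpace ℝ E]
  [completeE : CompleteSpace E]
  X : Type u
  [topX : TopologicalSpace X]
  [t2X : T2Space X]
  [chartedX : ChartedSpace E X]
  [manifoldX : IsManifold 𝓘(ℝ, E) ∞ X]
  π : X → M
  contMDiff_π : ContMDiff 𝓘(ℝ, E) 𝓘(ℝ, EM) ∞ π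
  localSections : HasLocalSections 𝓘(ℝ, E) 𝓘(ℝ, EM) π
  submanifold₂ : IsSubmanifold (𝓘(ℝ, E).prod 𝓘(ℝ, E)) (fib2 π)
  submanifold₃ : IsSubmanifold (𝓘(ℝ, E).prod (𝓘(ℝ, E).prod 𝓘(ℝ, E))) (fib3 π)
  P : CstarBundle (𝓘(ℝ, E).prod 𝓘(ℝ, E)) (fib2 π)
  m : ProductMap P
  assoc : ∀ (u v w : P.Tot) (h : (P.proj u).1 = (P.proj v).2) (h' : (P.proj v).1 = (P.proj w).2),
    ProductMap.app m u (ProductMap.app m v w h') (by rw [ProductMap.proj_app]; exact h) =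
      ProductMap.app m (ProductMap.app m u v h) w (by rw [ProductMap.proj_app]; exact h')

namespace BundleGerbe

attribute [instance] normE spaceE completeE topX t2X chartedX manifoldX

variable {EM : Type u} [NormedAddCommGroup EM] [NormedSpace ℝ EM] {M : Type u}
    [TopologicalSpace M] [ChartedSpace EM M]

/-- The bundle gerbe product `m(u ⊗ v)`. -/
abbrev mul (G : BundleGerbe EM M) (u v : G.P.Tot) (h : (G.P.proj u).1 = (G.P.proj v).2) : G.P.Tot :=
  ProductMap.app G.m u v h

section algebra

variable {G : BundleGerbe EM M}

theorem mul_congr {u u' v v' : G.P.Tot} (hu : u = u') (hv : v = v')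
    (h : (G.P.proj u).1 = (G.P.proj v).2) :
    G.mul u v h = G.mul u' v' (by rw [← hu, ← hv]; exact h) := by
  subst hu; subst hv; rfl

theorem mul_left_cancel {u u' v : G.P.Tot} {h : (G.P.proj u).1 = (G.P.proj v).2}
    {h' : (G.P.proj u').1 = (G.P.proj v).2} (hp : G.P.proj u = G.P.proj u')
    (e : G.mul u v h = G.mul u' v h') : u = u' := by
  obtain ⟨z, rfl⟩ := G.P.transitive u u' hp
  rw [mul, ProductMap.smul_app] at e
  rw [G.P.free z _ e, one_smul]

theorem mul_right_cancel {u v v' : G.P.Tot} {h : (G.P.proj u).1 = (G.P.proj v).2}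
    {h' : (G.P.proj u).1 = (G.P.proj v').2} (hp : G.P.proj v = G.P.proj v')
    (e : G.mul u v h = G.mul u v' h') : v = v' := by
  obtain ⟨z, rfl⟩ := G.P.transitive v v' hp
  rw [mul, ProductMap.app_smul] at e
  rw [G.P.free z _ e, one_smul]

theorem exists_ldiv (u w : G.P.Tot) (h : (G.P.proj u).2 = (G.P.proj w).2) :
    ∃ v : G.P.Tot, ∃ hv : G.P.proj v = ((G.P.proj w).1, (G.P.proj u).1),
      G.mul u v (by rw [hv]) = w := by
  have hm : ((G.P.proj w).1, (G.P.proj u).1) ∈ fib2 G.π := by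
    have h1 : G.π (G.P.proj w).1 = G.π (G.P.proj w).2 := G.P.proj_mem w
    have h2 : G.π (G.P.proj u).1 = G.π (G.P.proj u).2 := G.P.proj_mem u
    change G.π (G.P.proj w).1 = G.π (G.P.proj u).1
    rw [h1, h2, h]
  obtain ⟨v, hv⟩ := G.P.exists_over hm
  obtain ⟨z, hz⟩ := G.P.transitive w (G.mul u v (by rw [hv])) (by
    rw [ProductMap.proj_app, hv, h])
  refine ⟨z • v, (G.P.proj_smul _ _).trans hv, ?_⟩
  rw [mul, ProductMap.app_smul]
  exact hz.symm

end algebra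

/-- `u* ⊗ w` for `u` over `(x₂, x₃)` and `w` over `(x₁, x₃)`, multiplied in the bundle gerbe: the
point `v` over `(x₁, x₂)` with `m(u ⊗ v) = w`. -/
def ldiv (G : BundleGerbe EM M) (u w : G.P.Tot)
    (h : (G.P.proj u).2 = (G.P.proj w).2) : G.P.Tot :=
  (exists_ldiv u w h).choose

theorem proj_ldiv (G : BundleGerbe EM M) (u w : G.P.Tot) (h : (G.P.proj u).2 = (G.P.proj w).2) :
    G.P.proj (G.ldiv u w h) = ((G.P.proj w).1, (G.P.proj u).1) :=
  (exists_ldiv u w h).choose_spec.choose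

theorem mul_ldiv (G : BundleGerbe EM M) (u w : G.P.Tot) (h : (G.P.proj u).2 = (G.P.proj w).2) :
    G.mul u (G.ldiv u w h) (by rw [proj_ldiv]) = w :=
  (exists_ldiv u w h).choose_spec.choose_spec

/-- A bundle gerbe morphism `(f̂, f, id)` from `P` to `Q`: a smooth map `f : X → Y` over `M` and a
map of `ℂˣ`-bundles `f̂ : P → Q` over `f^[2]` commuting with the bundle gerbe products. -/
structure Morphism (P Q : BundleGerbe EM M) where
  f : P.X → Q.X
  contMDiff_f : ContMDiff 𝓘(ℝ, P.E) 𝓘(ℝ, Q.E) ∞ f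
  π_f : ∀ x, Q.π (f x) = P.π x
  fhat : HomOver (Prod.map f f) P.P Q.P
  map_mul : ∀ (u v : P.P.Tot) (h : (P.P.proj u).1 = (P.P.proj v).2),
    fhat.toFun (P.mul u v h) = Q.mul (fhat.toFun u) (fhat.toFun v) (by
      rw [fhat.proj_toFun, fhat.proj_toFun]; exact congrArg f h)

/-- The identity morphism. -/
def Morphism.id (P : BundleGerbe EM M) : Morphism P P where
  f := _root_.id
  contMDiff_f := contMDiff_id
  π_f _ := rfl
  fhat := HomOver.refl P.P
  map_mul _ _ _ := rfl

/-- Composition of bundle gerbe morphisms. -/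
def Morphism.comp {P Q R : BundleGerbe EM M} (g : Morphism Q R) (f : Morphism P Q) :
    Morphism P R where
  f := g.f ∘ f.f
  contMDiff_f := g.contMDiff_f.comp f.contMDiff_f
  π_f x := (g.π_f _).trans (f.π_f x)
  fhat := HomOver.comp (f.contMDiff_f.prodMap f.contMDiff_f) g.fhat f.fhat
  map_mul u v h := by
    change g.fhat.toFun (f.fhat.toFun _) = _
    rw [f.map_mul, g.map_mul]
    rfl

end BundleGerbe

end Gerbe

section Along

variable {E : Type u} [NormedAddCommGroup E] [NormedSpace ℝ E] {H : Type u} [TopologicalSpace H]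
  {I : ModelWithCorners ℝ E H} {B : Type u} [TopologicalSpace B] [ChartedSpace H B]
  {E' : Type u} [NormedAddCommGroup E'] [NormedSpace ℝ E'] {H' : Type u} [TopologicalSpace H']
  {J : ModelWithCorners ℝ E' H'} {C : Type u} [TopologicalSpace C] [ChartedSpace H' C]
  {E₃ : Type u} [NormedAddCommGroup E₃] [NormedSpace ℝ E₃] {H₃ : Type u}
  [TopologicalSpace H₃] {K : ModelWithCorners ℝ E₃ H₃} {D : Type u} [TopologicalSpace D]
  [ChartedSpace H₃ D]

namespace CstarBundle

variable {S : Set C} {P : CstarBundle J S} {A : Set B} {F : B → C} {σ : B → P.Tot}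

variable (I) in
/-- `σ` is a smooth section over `A ⊆ B` of the pullback of `P` by `F`. -/
def SmoothAlong (P : CstarBundle J S) (A : Set B) (F : B → C) (σ : B → P.Tot) : Prop :=
  (∀ b ∈ A, P.proj (σ b) = F b) ∧ ∀ e ∈ P.atlas, SmoothMultiple I (A ∩ F ⁻¹' e.1) σ (e.2 ∘ F)

theorem SmoothAlong.mono {A' : Set B} (h : P.SmoothAlong I A F σ) (hA : A' ⊆ A) :
    P.SmoothAlong I A' F σ :=
  ⟨fun b hb => h.1 b (hA hb), fun e he => (h.2 e he).mono (Set.inter_subset_inter_left _ hA)⟩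

theorem SmoothAlong.of_cover
    (h : ∀ b ∈ A, ∃ U : Set B, IsOpen U ∧ b ∈ U ∧ P.SmoothAlong I (A ∩ U) F σ) :
    P.SmoothAlong I A F σ := by
  refine ⟨fun b hb => ?_, fun e he => SmoothMultiple.of_local P.free fun b hb => ?_⟩
  · obtain ⟨U, _, hbU, hU⟩ := h b hb
    exact hU.1 b ⟨hb, hbU⟩
  · obtain ⟨U, hUo, hbU, hU⟩ := h b hb.1
    exact ⟨U, hUo, hbU, (hU.2 e he).mono fun c hc => ⟨⟨hc.1.1, hc.2⟩, hc.1.2⟩⟩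

theorem exists_chart_along (P : CstarBundle J S) (hF : ContMDiffOn I J ∞ F A) {b : B} (hb : b ∈ A)
    (hS : F b ∈ S) :
    ∃ e ∈ P.atlas, ∃ U : Set B, IsOpen U ∧ b ∈ U ∧ A ∩ U ⊆ F ⁻¹' e.1 := by
  obtain ⟨e, he, hbe⟩ := P.cover _ hS
  have h1 : F ⁻¹' e.1 ∈ 𝓝[A] b :=
    (hF.continuousOn b hb) ((P.isOpen_source e he).mem_nhds hbe)
  obtain ⟨U, hU, hbU, hUA⟩ := mem_nhdsWithin.1 h1
  exact ⟨e, he, U, hU, hbU, fun c hc => hUA ⟨hc.2, hc.1⟩⟩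

theorem SmoothAlong.of_local (hF : ContMDiffOn I J ∞ F A) (h1 : ∀ b ∈ A, P.proj (σ b) = F b)
    (h2 : ∀ b ∈ A, ∃ e ∈ P.atlas, ∃ U : Set B, IsOpen U ∧ b ∈ U ∧ A ∩ U ⊆ F ⁻¹' e.1 ∧
      SmoothMultiple I (A ∩ U) σ (e.2 ∘ F)) : P.SmoothAlong I A F σ := by
  refine ⟨h1, fun e' he' => SmoothMultiple.of_local P.free fun b hb => ?_⟩
  obtain ⟨e, he, U, hU, hbU, hUe, h⟩ := h2 b hb.1
  refine ⟨U, hU, hbU, (h.mono fun c hc => ⟨hc.1.1, hc.2⟩).trans ?_⟩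
  refine (P.transition e he e' he').comp (F := F) (hF.mono fun c hc => hc.1.1) fun c hc => ?_
  refine ⟨⟨hUe ⟨hc.1.1, hc.2⟩, hc.1.2⟩, ?_⟩
  rw [← h1 c hc.1.1]
  exact P.proj_mem _

theorem SmoothAlong.comp {P : CstarBundle J S} {A : Set C} {σ : C → P.Tot} (h : P.IsSmoothOn A σ)
    {A' : Set B} (hF : ContMDiffOn I J ∞ F A') (hA : Set.MapsTo F A' A) :
    P.SmoothAlong I A' F (σ ∘ F) :=
  ⟨fun _ hb => h.1 _ (hA hb), fun e he =>
    (h.2 e he).comp (hF.mono fun _ hc => hc.1) fun _ hc => ⟨hA hc.1, hc.2⟩⟩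

theorem HomOver.smoothAlong {S₃ : Set D} {R : CstarBundle K S₃} {G : C → D}
    (hG : ContMDiff J K ∞ G)
    (φ : HomOver G P R) (hF : ContMDiffOn I J ∞ F A) (h : P.SmoothAlong I A F σ) :
    R.SmoothAlong I A (G ∘ F) (φ.toFun ∘ σ) := by
  have hp : ∀ b ∈ A, R.proj (φ.toFun (σ b)) = G (F b) := fun b hb => by
    rw [φ.proj_toFun, h.1 b hb]
  refine SmoothAlong.of_local (hG.comp_contMDiffOn hF) hp fun b hb => ?_
  obtain ⟨e, he, U, hU, hbU, hUe⟩ := P.exists_chart_along hF hb (by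
    rw [← h.1 b hb]; exact P.proj_mem _)
  obtain ⟨k, hk, V, hV, hbV, hVk⟩ := R.exists_chart_along (hG.comp_contMDiffOn hF) hb (by
    change G (F b) ∈ S₃
    rw [← hp b hb]; exact R.proj_mem _)
  refine ⟨k, hk, U ∩ V, hU.inter hV, ⟨hbU, hbV⟩, fun c hc => hVk ⟨hc.1, hc.2.2⟩, ?_⟩
  obtain ⟨g, hg, hgs⟩ := h.2 e he
  have h1 : SmoothMultiple I (A ∩ (U ∩ V)) (φ.toFun ∘ σ) ((φ.toFun ∘ e.2) ∘ F) :=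
    ⟨g, hg.mono fun c hc => ⟨hc.1, hUe ⟨hc.1, hc.2.1⟩⟩, fun c hc => by
      have := hgs c ⟨hc.1, hUe ⟨hc.1, hc.2.1⟩⟩
      simp only [Function.comp] at this ⊢
      rw [this, φ.map_smul]⟩
  refine h1.trans ((φ.smooth e he k hk).comp (F := F) (hF.mono fun c hc => hc.1) fun c hc =>
    ⟨⟨hUe ⟨hc.1, hc.2.1⟩, hVk ⟨hc.1, hc.2.2⟩⟩, ?_⟩)
  rw [← h.1 c hc.1]
  exact P.proj_mem _

theorem smoothAlong_of_pullback {S₃ : Set D} {R : CstarBundle K S₃} {G : C → D}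
    {hG : ContMDiff J K ∞ G} {T : Set C} {hT : Set.MapsTo G T S₃}
    {τ : B → (R.pullback G hG T hT).Tot} (h : (R.pullback G hG T hT).SmoothAlong I A F τ) :
    R.SmoothAlong I A (G ∘ F) (fun b => (τ b).1.2) := by
  refine ⟨fun b hb => ?_, fun e he => SmoothMultiple.of_local R.free fun b hb => ?_⟩
  · exact (τ b).2.2.trans (congrArg G (h.1 b hb))
  · have hbT : F b ∈ T := by rw [← h.1 b hb.1]; exact (τ b).2.1
    obtain ⟨k, hk, hkU, hks⟩ := R.pullback_exists_atlas G hG T hT hbT he hb.2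
    obtain ⟨g, hg, hgs⟩ := h.2 k hk
    have hsub : A ∩ (G ∘ F) ⁻¹' e.1 ⊆ A ∩ F ⁻¹' k.1 := by
      rw [hkU]; exact fun c hc => hc
    refine ⟨Set.univ, isOpen_univ, Set.mem_univ _, g, hg.mono fun c hc => hsub hc.1,
      fun c hc => ?_⟩
    have hcT : F c ∈ T := by rw [← h.1 c hc.1.1]; exact (τ c).2.1
    have h1 := congrArg (fun w => w.1.2) (hgs c (hsub hc.1))
    refine h1.trans ?_
    change g c • (k.2 (F c)).1.2 = _
    rw [(hks (F c) ⟨(hsub hc.1).2, hcT⟩).2]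
    rfl

theorem smoothAlong_pullback {S₃ : Set D} {R : CstarBundle K S₃} {G : C → D}
    {hG : ContMDiff J K ∞ G} {T : Set C} {hT : Set.MapsTo G T S₃}
    {τ : B → (R.pullback G hG T hT).Tot} (h1 : ∀ b ∈ A, (τ b).1.1 = F b)
    (h : R.SmoothAlong I A (G ∘ F) (fun b => (τ b).1.2)) :
    (R.pullback G hG T hT).SmoothAlong I A F τ := by
  refine ⟨h1, ?_⟩
  rintro k ⟨e, he, hk, hks⟩
  obtain ⟨g, hg, hgs⟩ := h.2 e he
  have hsub : A ∩ F ⁻¹' k.1 ⊆ A ∩ (G ∘ F) ⁻¹' e.1 := by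
    rw [hk]; exact fun c hc => hc
  refine ⟨g, hg.mono hsub, fun c hc => ?_⟩
  have hcT : F c ∈ T := by rw [← h1 c hc.1]; exact (τ c).2.1
  obtain ⟨q1, q2⟩ := hks (F c) ⟨hc.2, hcT⟩
  refine Subtype.ext (Prod.ext ((h1 c hc.1).trans q1.symm) ?_)
  refine (hgs c (hsub hc)).trans ?_
  change _ = g c • (k.2 (F c)).1.2
  rw [q2]
  rfl

end CstarBundle

namespace BundleGerbe

open CstarBundle

variable {EM : Type u} [NormedAddCommGroup EM] [NormedSpace ℝ EM] {M : Type u}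
    [TopologicalSpace M] [ChartedSpace EM M] {G : BundleGerbe EM M} {A : Set B} {a b c : B → G.X}
    {u v w : B → G.P.Tot}

theorem exists_mul_charts (ha : ContMDiffOn I 𝓘(ℝ, G.E) ∞ a A)
    (hb : ContMDiffOn I 𝓘(ℝ, G.E) ∞ b A) (hc : ContMDiffOn I 𝓘(ℝ, G.E) ∞ c A)
    (hab : ∀ x ∈ A, (a x, b x) ∈ fib2 G.π) (hbc : ∀ x ∈ A, (b x, c x) ∈ fib2 G.π) {x : B}
    (hx : x ∈ A) :
    ∃ e₁ ∈ G.P.atlas, ∃ e₂ ∈ G.P.atlas, ∃ e₃ ∈ G.P.atlas, ∃ U : Set B, IsOpen U ∧ x ∈ U ∧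
      (∀ y ∈ A ∩ U, (b y, c y) ∈ e₁.1 ∧ (a y, c y) ∈ e₂.1 ∧ (a y, b y) ∈ e₃.1) ∧
      ∃ g : B → ℂˣ, ContMDiffOn I 𝓘(ℝ, ℂ) ∞ g (A ∩ U) ∧ ∀ y ∈ A ∩ U, ∀ h,
        G.mul (e₁.2 (b y, c y)) (e₃.2 (a y, b y)) h = g y • e₂.2 (a y, c y) := by
  have hac : ∀ x ∈ A, (a x, c x) ∈ fib2 G.π := fun x hx => (hab x hx).trans (hbc x hx)
  obtain ⟨e₁, he₁, U₁, hU₁, hx₁, h₁⟩ := G.P.exists_chart_along (hb.prodMk hc) hx (hbc x hx)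
  obtain ⟨e₂, he₂, U₂, hU₂, hx₂, h₂⟩ := G.P.exists_chart_along (ha.prodMk hc) hx (hac x hx)
  obtain ⟨e₃, he₃, U₃, hU₃, hx₃, h₃⟩ := G.P.exists_chart_along (ha.prodMk hb) hx (hab x hx)
  obtain ⟨g, hg, hgs⟩ := ProductMap.smooth G.m he₁ he₂ he₃
    (A := {z | z ∈ fib3 G.π ∧ face₁ z ∈ e₁.1 ∧ face₂ z ∈ e₂.1 ∧ face₃ z ∈ e₃.1})
    (fun z hz => hz.1) (fun z hz => hz.2.1) (fun z hz => hz.2.2.1) (fun z hz => hz.2.2.2)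
  have hmem : ∀ y ∈ A ∩ (U₁ ∩ (U₂ ∩ U₃)),
      (b y, c y) ∈ e₁.1 ∧ (a y, c y) ∈ e₂.1 ∧ (a y, b y) ∈ e₃.1 := fun y hy =>
    ⟨h₁ ⟨hy.1, hy.2.1⟩, h₂ ⟨hy.1, hy.2.2.1⟩, h₃ ⟨hy.1, hy.2.2.2⟩⟩
  have hmaps : Set.MapsTo (fun y => (a y, b y, c y)) (A ∩ (U₁ ∩ (U₂ ∩ U₃)))
      {z | z ∈ fib3 G.π ∧ face₁ z ∈ e₁.1 ∧ face₂ z ∈ e₂.1 ∧ face₃ z ∈ e₃.1} := fun y hy =>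
    ⟨⟨hab y hy.1, hbc y hy.1⟩, (hmem y hy).1, (hmem y hy).2.1, (hmem y hy).2.2⟩
  exact ⟨e₁, he₁, e₂, he₂, e₃, he₃, U₁ ∩ (U₂ ∩ U₃), hU₁.inter (hU₂.inter hU₃), ⟨hx₁, hx₂, hx₃⟩, hmem,
    fun y => g (a y, b y, c y),
    hg.comp ((ha.prodMk (hb.prodMk hc)).mono fun y hy => hy.1) hmaps,
    fun y hy h => hgs _ (hmaps hy) h⟩

theorem mul_smul_smul {z z' : ℂˣ} {p q : G.P.Tot} (h : (G.P.proj (z • p)).1 = (G.P.proj (z' • q)).2)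
    (h') : G.mul (z • p) (z' • q) h = (z * z') • G.mul p q h' := by
  rw [mul, ProductMap.smul_app, ProductMap.app_smul, mul_smul]

theorem smoothAlong_mul (ha : ContMDiffOn I 𝓘(ℝ, G.E) ∞ a A)
    (hb : ContMDiffOn I 𝓘(ℝ, G.E) ∞ b A) (hc : ContMDiffOn I 𝓘(ℝ, G.E) ∞ c A)
    (hu : G.P.SmoothAlong I A (fun x => (b x, c x)) u)
    (hv : G.P.SmoothAlong I A (fun x => (a x, b x)) v)
    (hw : ∀ x ∈ A, ∀ h, w x = G.mul (u x) (v x) h) :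
    G.P.SmoothAlong I A (fun x => (a x, c x)) w := by
  have hh : ∀ x ∈ A, (G.P.proj (u x)).1 = (G.P.proj (v x)).2 := fun x hx => by
    rw [hu.1 x hx, hv.1 x hx]
  refine SmoothAlong.of_local (ha.prodMk hc) (fun x hx => ?_) fun x hx => ?_
  · rw [hw x hx (hh x hx), ProductMap.proj_app, hu.1 x hx, hv.1 x hx]
  obtain ⟨e₁, he₁, e₂, he₂, e₃, he₃, U, hU, hxU, hm, g, hg, hgs⟩ := exists_mul_charts ha hb hc
    (fun x hx => by have := G.P.proj_mem (v x); rwa [hv.1 x hx] at this)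
    (fun x hx => by have := G.P.proj_mem (u x); rwa [hu.1 x hx] at this) hx
  refine ⟨e₂, he₂, U, hU, hxU, fun y hy => (hm y hy).2.1, ?_⟩
  obtain ⟨k, hk, hks⟩ := hu.2 e₁ he₁
  obtain ⟨l, hl, hls⟩ := hv.2 e₃ he₃
  refine ⟨fun y => k y * l y * g y, ((hk.mono fun y hy => ⟨hy.1, (hm y hy).1⟩).mul
    (hl.mono fun y hy => ⟨hy.1, (hm y hy).2.2⟩)).mul hg, fun y hy => ?_⟩
  have h1 := hks y ⟨hy.1, (hm y hy).1⟩
  have h2 := hls y ⟨hy.1, (hm y hy).2.2⟩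
  simp only [Function.comp] at h1 h2
  have h0 := hh y hy.1
  rw [hw y hy.1 h0, mul_congr h1 h2, mul_smul_smul _ (by
    rw [h1, h2, G.P.proj_smul, G.P.proj_smul] at h0; exact h0), hgs y hy, ← mul_smul]
  rfl

theorem smoothAlong_ldiv (ha : ContMDiffOn I 𝓘(ℝ, G.E) ∞ a A)
    (hb : ContMDiffOn I 𝓘(ℝ, G.E) ∞ b A) (hc : ContMDiffOn I 𝓘(ℝ, G.E) ∞ c A)
    (hu : G.P.SmoothAlong I A (fun x => (b x, c x)) u)
    (hw : G.P.SmoothAlong I A (fun x => (a x, c x)) w)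
    (hv : ∀ x ∈ A, G.P.proj (v x) = (a x, b x))
    (hvw : ∀ x ∈ A, ∀ h, w x = G.mul (u x) (v x) h) :
    G.P.SmoothAlong I A (fun x => (a x, b x)) v := by
  have hh : ∀ x ∈ A, (G.P.proj (u x)).1 = (G.P.proj (v x)).2 := fun x hx => by
    rw [hu.1 x hx, hv x hx]
  refine SmoothAlong.of_local (ha.prodMk hb) hv fun x hx => ?_
  obtain ⟨e₁, he₁, e₂, he₂, e₃, he₃, U, hU, hxU, hm, g, hg, hgs⟩ := exists_mul_charts ha hb hc
    (fun x hx => by rw [← hv x hx]; exact G.P.proj_mem _)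
    (fun x hx => by have := G.P.proj_mem (u x); rwa [hu.1 x hx] at this) hx
  refine ⟨e₃, he₃, U, hU, hxU, fun y hy => (hm y hy).2.2, ?_⟩
  obtain ⟨k, hk, hks⟩ := hu.2 e₁ he₁
  obtain ⟨l, hl, hls⟩ := hw.2 e₂ he₂
  refine ⟨fun y => l y * (k y * g y)⁻¹, (hl.mono fun y hy => ⟨hy.1, (hm y hy).2.1⟩).mul
    ((hk.mono fun y hy => ⟨hy.1, (hm y hy).1⟩).mul hg).inv, fun y hy => ?_⟩
  have h1 := hks y ⟨hy.1, (hm y hy).1⟩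
  have h2 := hls y ⟨hy.1, (hm y hy).2.1⟩
  simp only [Function.comp] at h1 h2
  have hab : (a y, b y) ∈ fib2 G.π := by rw [← hv y hy.1]; exact G.P.proj_mem _
  obtain ⟨t, ht⟩ := G.P.transitive (v y) (e₃.2 (a y, b y)) (by
    rw [hv y hy.1, G.P.proj_section e₃ he₃ _ ⟨(hm y hy).2.2, hab⟩])
  have h0 := hh y hy.1
  have h3 := hvw y hy.1 h0
  have h4 : l y • e₂.2 (a y, c y) = (k y * t * g y) • e₂.2 (a y, c y) := by
    rw [← h2, h3, mul_congr h1 ht, mul_smul_smul _ (by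
      rw [h1, ht, G.P.proj_smul, G.P.proj_smul] at h0; exact h0), hgs y hy, ← mul_smul]
  have h5 := G.P.smul_left_injective h4
  change v y = (l y * (k y * g y)⁻¹) • e₃.2 (a y, b y)
  rw [ht, h5]
  congr 1
  rw [eq_mul_inv_iff_mul_eq, mul_left_comm, mul_assoc]

end BundleGerbe

end Along

noncomputable section Transformations

namespace BundleGerbe

open CstarBundle

variable {EM : Type u} [NormedAddCommGroup EM] [NormedSpace ℝ EM] {M : Type u}
    [TopologicalSpace M] [ChartedSpace EM M]

section

variable {P Q : BundleGerbe EM M} (f g : Morphism P Q)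

/-- The map `(f, g) : X → Y^[2]`. -/
def pairMap (x : P.X) : Q.X × Q.X := (f.f x, g.f x)

theorem contMDiff_pairMap :
    ContMDiff 𝓘(ℝ, P.E) (𝓘(ℝ, Q.E).prod 𝓘(ℝ, Q.E)) ∞ (pairMap f g) :=
  f.contMDiff_f.prodMk g.contMDiff_f

theorem mapsTo_pairMap : Set.MapsTo (pairMap f g) Set.univ (fib2 Q.π) := fun x _ =>
  (f.π_f x).trans (g.π_f x).symm

/-- The `ℂˣ`-bundle `D̂ = (f, g)⁻¹Q` on `X`. -/
def Dhat : CstarBundle 𝓘(ℝ, P.E) (Set.univ : Set P.X) :=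
  Q.P.pullback (pairMap f g) (contMDiff_pairMap f g) Set.univ (mapsTo_pairMap f g)

variable {f g}

theorem fhat_proj_of {p : P.P.Tot} {z : P.X × P.X} (hp : P.P.proj p = z) :
    Q.P.proj (f.fhat.toFun p) = (f.f z.1, f.f z.2) := by
  rw [f.fhat.proj_toFun, hp]; rfl

variable (f g)

/-- For `p ∈ P` over `(x₁, x₂)` and `ξ` over `(f x₂, g x₂)` the point
`m(m(ĝ(p)* ⊗ ξ) ⊗ f̂(p)) = m(ĝ(p)* ⊗ m(ξ ⊗ f̂(p)))` over `(f x₁, g x₁)`. -/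
def descentVal (p : P.P.Tot) (ξ : Q.P.Tot) (h : Q.P.proj ξ = pairMap f g (P.P.proj p).2) :
    Q.P.Tot :=
  Q.ldiv (g.fhat.toFun p)
    (Q.mul ξ (f.fhat.toFun p) (by rw [h, f.fhat.proj_toFun]; rfl))
    (by rw [ProductMap.proj_app, h, g.fhat.proj_toFun]; rfl)

variable {f g}

theorem proj_descentVal (p : P.P.Tot) (ξ : Q.P.Tot)
    (h : Q.P.proj ξ = pairMap f g (P.P.proj p).2) :
    Q.P.proj (descentVal f g p ξ h) = pairMap f g (P.P.proj p).1 := by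
  rw [descentVal, proj_ldiv, ProductMap.proj_app, f.fhat.proj_toFun, g.fhat.proj_toFun]; rfl

theorem mul_descentVal (p : P.P.Tot) (ξ : Q.P.Tot)
    (h : Q.P.proj ξ = pairMap f g (P.P.proj p).2) :
    Q.mul (g.fhat.toFun p) (descentVal f g p ξ h)
      (by rw [proj_descentVal, g.fhat.proj_toFun]; rfl) =
    Q.mul ξ (f.fhat.toFun p) (by rw [h, f.fhat.proj_toFun]; rfl) :=
  mul_ldiv _ _ _ _

/-- The points `ξ`, `ξ'` over `(f x₂, g x₂)`, `(f x₁, g x₁)` correspond under the descent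
isomorphism, tested on `p` over `(x₁, x₂)`. -/
def Matches (f g : Morphism P Q) (p : P.P.Tot) (ξ ξ' : Q.P.Tot) : Prop :=
  ∃ h h', Q.mul ξ (f.fhat.toFun p) h = Q.mul (g.fhat.toFun p) ξ' h'

theorem matches_descentVal (p : P.P.Tot) (ξ : Q.P.Tot)
    (h : Q.P.proj ξ = pairMap f g (P.P.proj p).2) : Matches f g p ξ (descentVal f g p ξ h) :=
  ⟨_, _, (mul_descentVal p ξ h).symm⟩

theorem Matches.unique {p : P.P.Tot} {ξ ξ' ξ'' : Q.P.Tot} (h : Matches f g p ξ ξ')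
    (h' : Matches f g p ξ ξ'') (hp : Q.P.proj ξ' = Q.P.proj ξ'') : ξ' = ξ'' := by
  obtain ⟨_, _, h⟩ := h
  obtain ⟨_, _, h'⟩ := h'
  exact mul_right_cancel hp (h.symm.trans h')

theorem Matches.of_proj_eq {p p' : P.P.Tot} {ξ ξ' : Q.P.Tot} (h : Matches f g p ξ ξ')
    (hp : P.P.proj p' = P.P.proj p) : Matches f g p' ξ ξ' := by
  obtain ⟨z, rfl⟩ := P.P.transitive p' p hp
  obtain ⟨h1, h2, h⟩ := h
  refine ⟨by rw [f.fhat.map_smul, Q.P.proj_smul]; exact h1,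
    by rw [g.fhat.map_smul, Q.P.proj_smul]; exact h2, ?_⟩
  rw [mul_congr rfl (f.fhat.map_smul z p), mul_congr (g.fhat.map_smul z p) rfl, mul,
    ProductMap.app_smul, mul, ProductMap.smul_app]
  exact congrArg (z • ·) h

theorem Matches.smul {p : P.P.Tot} {ξ ξ' : Q.P.Tot} (h : Matches f g p ξ ξ') (z : ℂˣ) :
    Matches f g p (z • ξ) (z • ξ') := by
  obtain ⟨h1, h2, h⟩ := h
  refine ⟨by rw [Q.P.proj_smul]; exact h1, by rw [Q.P.proj_smul]; exact h2, ?_⟩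
  rw [mul, ProductMap.smul_app, mul, ProductMap.app_smul]
  exact congrArg (z • ·) h

/-- For `p` over `(x₂, x₃)` and `p'` over `(x₁, x₂)`. -/
theorem Matches.trans {p p' : P.P.Tot} {ξ ξ' ξ'' : Q.P.Tot} (h : Matches f g p ξ ξ')
    (h' : Matches f g p' ξ' ξ'') (hp : (P.P.proj p).1 = (P.P.proj p').2) :
    Matches f g (P.mul p p' hp) ξ ξ'' := by
  obtain ⟨a, b, h⟩ := h
  obtain ⟨a', b', h'⟩ := h'
  have hf : (Q.P.proj (f.fhat.toFun p)).1 = (Q.P.proj (f.fhat.toFun p')).2 := by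
    rw [f.fhat.proj_toFun, f.fhat.proj_toFun]; exact congrArg f.f hp
  have hg : (Q.P.proj (g.fhat.toFun p)).1 = (Q.P.proj (g.fhat.toFun p')).2 := by
    rw [g.fhat.proj_toFun, g.fhat.proj_toFun]; exact congrArg g.f hp
  refine ⟨by rw [f.map_mul, ProductMap.proj_app]; exact a,
    by rw [g.map_mul, ProductMap.proj_app]; exact b', ?_⟩
  calc Q.mul ξ (f.fhat.toFun (P.mul p p' hp)) _
      = Q.mul ξ (Q.mul (f.fhat.toFun p) (f.fhat.toFun p') hf)
          (by rw [ProductMap.proj_app]; exact a) := mul_congr rfl (f.map_mul _ _ _) _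
    _ = Q.mul (Q.mul ξ (f.fhat.toFun p) a) (f.fhat.toFun p')
          (by rw [ProductMap.proj_app]; exact hf) := Q.assoc _ _ _ a hf
    _ = Q.mul (Q.mul (g.fhat.toFun p) ξ' b) (f.fhat.toFun p')
          (by rw [ProductMap.proj_app]; exact a') := mul_congr h rfl _
    _ = Q.mul (g.fhat.toFun p) (Q.mul ξ' (f.fhat.toFun p') a')
          (by rw [ProductMap.proj_app]; exact b) := (Q.assoc _ _ _ b a').symm
    _ = Q.mul (g.fhat.toFun p) (Q.mul (g.fhat.toFun p') ξ'' b')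
          (by rw [ProductMap.proj_app]; exact hg) := mul_congr rfl h' _
    _ = Q.mul (Q.mul (g.fhat.toFun p) (g.fhat.toFun p') hg) ξ''
          (by rw [ProductMap.proj_app]; exact b') := Q.assoc _ _ _ hg b'
    _ = Q.mul (g.fhat.toFun (P.mul p p' hp)) ξ'' _ := mul_congr (g.map_mul _ _ _).symm rfl _

variable (f g)

/-- A choice of `p ∈ P` over a point of `X^[2]`. -/
def somePoint {z : P.X × P.X} (hz : z ∈ fib2 P.π) : P.P.Tot := (P.P.exists_over hz).choose

theorem proj_somePoint {z : P.X × P.X} (hz : z ∈ fib2 P.π) : P.P.proj (somePoint hz) = z :=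
  (P.P.exists_over hz).choose_spec

theorem proj_pullback_snd
    (w : ((Dhat f g).pullback (I := 𝓘(ℝ, P.E).prod 𝓘(ℝ, P.E)) Prod.snd contMDiff_snd (fib2 P.π)
      (Set.mapsTo_univ _ _)).Tot) :
    Q.P.proj w.1.2.1.2 = pairMap f g (P.P.proj (somePoint w.2.1)).2 :=
  w.1.2.2.2.trans (congrArg (pairMap f g)
    (w.2.2.trans (congrArg Prod.snd (proj_somePoint w.2.1).symm)))

/-- The map `φ` underlying the descent isomorphism. It does not depend on the choice of `p`. -/
def descentFun
    (w : ((Dhat f g).pullback (I := 𝓘(ℝ, P.E).prod 𝓘(ℝ, P.E)) Prod.snd contMDiff_snd (fib2 P.π)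
      (Set.mapsTo_univ _ _)).Tot) :
    ((Dhat f g).pullback (I := 𝓘(ℝ, P.E).prod 𝓘(ℝ, P.E)) Prod.fst contMDiff_fst (fib2 P.π)
      (Set.mapsTo_univ _ _)).Tot :=
  ⟨(w.1.1, ⟨(w.1.1.1, descentVal f g (somePoint w.2.1) w.1.2.1.2 (proj_pullback_snd f g w)),
    Set.mem_univ _, (proj_descentVal _ _ (proj_pullback_snd f g w)).trans
      (congrArg (fun z => pairMap f g z.1) (proj_somePoint w.2.1))⟩), w.2.1, rfl⟩

variable {f g}

theorem matches_descentFun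
    (w : ((Dhat f g).pullback (I := 𝓘(ℝ, P.E).prod 𝓘(ℝ, P.E)) Prod.snd contMDiff_snd (fib2 P.π)
      (Set.mapsTo_univ _ _)).Tot) (p : P.P.Tot) (hp : P.P.proj p = w.1.1) :
    Matches f g p w.1.2.1.2 (descentFun f g w).1.2.1.2 := by
  have h := matches_descentVal (f := f) (g := g) (somePoint w.2.1) w.1.2.1.2
    (proj_pullback_snd f g w)
  exact h.of_proj_eq (hp.trans (proj_somePoint w.2.1).symm)

theorem Dhat_ext {a b : (Dhat f g).Tot} (h : (Dhat f g).proj a = (Dhat f g).proj b)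
    (h' : a.1.2 = b.1.2) : a = b := Subtype.ext (Prod.ext h h')

variable (f g)

/-- The descent isomorphism `φ : π₁⁻¹D̂ → π₂⁻¹D̂` as a map of bundles over `X^[2]`. -/
def descentHom :
    Hom ((Dhat f g).pullback (I := 𝓘(ℝ, P.E).prod 𝓘(ℝ, P.E)) Prod.snd contMDiff_snd (fib2 P.π)
      (Set.mapsTo_univ _ _))
    ((Dhat f g).pullback (I := 𝓘(ℝ, P.E).prod 𝓘(ℝ, P.E)) Prod.fst contMDiff_fst (fib2 P.π)
      (Set.mapsTo_univ _ _)) where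
  toFun := descentFun f g
  proj_toFun _ := rfl
  map_smul z w := by
    refine Subtype.ext (Prod.ext rfl (Dhat_ext rfl ?_))
    obtain ⟨p, hp⟩ := P.P.exists_over w.2.1
    have h1 : Matches f g p (z • w.1.2.1.2) (descentFun f g (z • w)).1.2.1.2 :=
      matches_descentFun (z • w) p hp
    have h2 := (matches_descentFun w p hp).smul z
    refine h1.unique h2 ?_
    exact (descentFun f g (z • w)).1.2.2.2.trans
      ((descentFun f g w).1.2.2.2.symm.trans (Q.P.proj_smul _ _).symm)
  smooth k hk k' hk' := by
    have hsec := isSmoothOn_atlas _ hk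
    have h0 : ((Dhat f g).pullback (I := 𝓘(ℝ, P.E).prod 𝓘(ℝ, P.E)) Prod.snd contMDiff_snd
        (fib2 P.π) (Set.mapsTo_univ _ _)).SmoothAlong (𝓘(ℝ, P.E).prod 𝓘(ℝ, P.E)) (k.1 ∩ fib2 P.π)
        id k.2 := hsec
    have h1 : Q.P.SmoothAlong (𝓘(ℝ, P.E).prod 𝓘(ℝ, P.E)) (k.1 ∩ fib2 P.π)
        (fun z => (f.f z.2, g.f z.2)) (fun z => (k.2 z).1.2.1.2) :=
      smoothAlong_of_pullback (smoothAlong_of_pullback h0)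
    have cf1 : ContMDiff (𝓘(ℝ, P.E).prod 𝓘(ℝ, P.E)) 𝓘(ℝ, Q.E) ∞ (fun z : P.X × P.X => f.f z.1) :=
      f.contMDiff_f.comp contMDiff_fst
    have cf2 : ContMDiff (𝓘(ℝ, P.E).prod 𝓘(ℝ, P.E)) 𝓘(ℝ, Q.E) ∞ (fun z : P.X × P.X => f.f z.2) :=
      f.contMDiff_f.comp contMDiff_snd
    have cg1 : ContMDiff (𝓘(ℝ, P.E).prod 𝓘(ℝ, P.E)) 𝓘(ℝ, Q.E) ∞ (fun z : P.X × P.X => g.f z.1) :=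
      g.contMDiff_f.comp contMDiff_fst
    have cg2 : ContMDiff (𝓘(ℝ, P.E).prod 𝓘(ℝ, P.E)) 𝓘(ℝ, Q.E) ∞ (fun z : P.X × P.X => g.f z.2) :=
      g.contMDiff_f.comp contMDiff_snd
    have h2 : Q.P.SmoothAlong (𝓘(ℝ, P.E).prod 𝓘(ℝ, P.E)) (k.1 ∩ fib2 P.π)
        (fun z => (f.f z.1, g.f z.1)) (fun z => (descentFun f g (k.2 z)).1.2.1.2) := by
      refine SmoothAlong.of_cover fun z hz => ?_
      obtain ⟨e, he, hze⟩ := P.P.cover z hz.2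
      refine ⟨e.1, P.P.isOpen_source e he, hze, ?_⟩
      have hA : (k.1 ∩ fib2 P.π) ∩ e.1 ⊆ e.1 ∩ fib2 P.π := fun y hy => ⟨hy.2, hy.1.2⟩
      have he' : P.P.SmoothAlong (𝓘(ℝ, P.E).prod 𝓘(ℝ, P.E)) ((k.1 ∩ fib2 P.π) ∩ e.1) id e.2 :=
        (P.P.isSmoothOn_atlas he).mono hA
      have hf := HomOver.smoothAlong (f.contMDiff_f.prodMap f.contMDiff_f) f.fhat contMDiffOn_id he'
      have hg := HomOver.smoothAlong (g.contMDiff_f.prodMap g.contMDiff_f) g.fhat contMDiffOn_id he'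
      have hpr : ∀ y ∈ (k.1 ∩ fib2 P.π) ∩ e.1, P.P.proj (e.2 y) = (k.2 y).1.1 := fun y hy =>
        (he'.1 y hy).trans (h0.1 y hy.1).symm
      have hmt : ∀ y ∈ (k.1 ∩ fib2 P.π) ∩ e.1,
          Matches f g (e.2 y) (k.2 y).1.2.1.2 (descentFun f g (k.2 y)).1.2.1.2 := fun y hy =>
        matches_descentFun (k.2 y) (e.2 y) (hpr y hy)
      classical
      let w : P.X × P.X → Q.P.Tot := fun y =>
        if h : (Q.P.proj (k.2 y).1.2.1.2).1 = (Q.P.proj (f.fhat.toFun (e.2 y))).2 then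
          Q.mul (k.2 y).1.2.1.2 (f.fhat.toFun (e.2 y)) h else (k.2 y).1.2.1.2
      have hw : Q.P.SmoothAlong (𝓘(ℝ, P.E).prod 𝓘(ℝ, P.E)) ((k.1 ∩ fib2 P.π) ∩ e.1)
          (fun z => (f.f z.1, g.f z.2)) w :=
        smoothAlong_mul cf1.contMDiffOn cf2.contMDiffOn cg2.contMDiffOn
          (h1.mono fun y hy => hy.1) hf fun y hy h => dif_pos h
      refine smoothAlong_ldiv cf1.contMDiffOn cg1.contMDiffOn cg2.contMDiffOn hg hw ?_ ?_
      · intro y hy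
        refine (descentFun f g (k.2 y)).1.2.2.2.trans ?_
        change (f.f (k.2 y).1.1.1, g.f (k.2 y).1.1.1) = _
        rw [← hpr y hy, he'.1 y hy]
        rfl
      · intro y hy h
        obtain ⟨a, b, hab⟩ := hmt y hy
        exact (dif_pos a).trans hab
    have h3 : ((Dhat f g).pullback (I := 𝓘(ℝ, P.E).prod 𝓘(ℝ, P.E)) Prod.fst contMDiff_fst
        (fib2 P.π) (Set.mapsTo_univ _ _)).SmoothAlong (𝓘(ℝ, P.E).prod 𝓘(ℝ, P.E)) (k.1 ∩ fib2 P.π)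
        id (fun z => descentFun f g (k.2 z)) := by
      refine smoothAlong_pullback (fun z hz => h0.1 z hz) (smoothAlong_pullback (fun z hz => ?_) h2)
      exact congrArg Prod.fst (h0.1 z hz)
    exact (h3.2 k' hk').mono fun z hz => ⟨⟨hz.1.1, hz.2⟩, hz.1.2⟩

/-- The descent isomorphism of `D̂`. -/
def descentIso : DescentIso P.π (Dhat f g) where
  φ := descentHom f g
  gluing x₁ x₂ q h₁₂ h₂₃ := by
    refine Dhat_ext (by rw [proj_descentApp, proj_descentApp]) ?_
    obtain ⟨p, hp⟩ := P.P.exists_over (b := (x₂, (Dhat f g).proj q)) h₂₃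
    obtain ⟨p', hp'⟩ := P.P.exists_over (b := (x₁, x₂)) h₁₂
    have hpp : (P.P.proj p).1 = (P.P.proj p').2 := by rw [hp, hp']
    let q' := descentApp (descentHom f g) x₂ q h₂₃
    have hq' : (Dhat f g).proj q' = x₂ := proj_descentApp _ _ _ _
    have m1 : Matches f g p q.1.2 q'.1.2 :=
      matches_descentFun (f := f) (g := g) ⟨((x₂, (Dhat f g).proj q), q), h₂₃, rfl⟩ p hp
    have m2 : Matches f g p' q'.1.2
        (descentApp (descentHom f g) x₁ q' (h₁₂.trans (by rw [hq']))).1.2 :=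
      matches_descentFun (f := f) (g := g)
        ⟨((x₁, (Dhat f g).proj q'), q'), h₁₂.trans (by rw [hq']), rfl⟩ p'
        (hp'.trans (Prod.ext rfl hq'.symm))
    have m3 : Matches f g (P.mul p p' hpp) q.1.2
        (descentApp (descentHom f g) x₁ q (h₁₂.trans h₂₃)).1.2 :=
      matches_descentFun (f := f) (g := g)
        ⟨((x₁, (Dhat f g).proj q), q), h₁₂.trans h₂₃, rfl⟩ _ ((ProductMap.proj_app _ _ _ _).trans
        (by rw [hp, hp']))
    refine (m1.trans m2 hpp).unique m3 ?_
    refine (descentApp (descentHom f g) x₁ q' _).2.2.trans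
      (Eq.trans ?_ (descentApp (descentHom f g) x₁ q _).2.2.symm)
    exact congrArg (pairMap f g) ((proj_descentApp (descentHom f g) x₁ q' (h₁₂.trans
      (by rw [hq']))).trans (proj_descentApp (descentHom f g) x₁ q (h₁₂.trans h₂₃)).symm)

/-- The `ℂˣ`-bundle `D_{f,g}` on `M` to which `D̂ = (f, g)⁻¹Q` descends. -/
def D : CstarBundle 𝓘(ℝ, EM) (Set.univ : Set M) :=
  descend P.contMDiff_π P.localSections (descentIso f g)

/-- A transformation `f ⇒ g`: a section of the bundle `D_{f,g}`. -/
abbrev Transformation := GlobalSection (D f g)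

end

end BundleGerbe

end Transformations

section AlongComp

variable {E : Type u} [NormedAddCommGroup E] [NormedSpace ℝ E] {H : Type u} [TopologicalSpace H]
  {I : ModelWithCorners ℝ E H} {B : Type u} [TopologicalSpace B] [ChartedSpace H B]
  {E' : Type u} [NormedAddCommGroup E'] [NormedSpace ℝ E'] {H' : Type u} [TopologicalSpace H']
  {J : ModelWithCorners ℝ E' H'} {C : Type u} [TopologicalSpace C] [ChartedSpace H' C]
  {E₃ : Type u} [NormedAddCommGroup E₃] [NormedSpace ℝ E₃] {H₃ : Type u}
  [TopologicalSpace H₃] {K : ModelWithCorners ℝ E₃ H₃} {D : Type u} [TopologicalSpace D]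
  [ChartedSpace H₃ D]

theorem CstarBundle.SmoothAlong.comp_right {S : Set C} {P : CstarBundle J S} {A : Set B}
    {F : B → C} {σ : B → P.Tot} (h : P.SmoothAlong I A F σ) {A' : Set D} {G : D → B}
    (hG : ContMDiffOn K I ∞ G A') (hA : Set.MapsTo G A' A) :
    P.SmoothAlong K A' (F ∘ G) (σ ∘ G) :=
  ⟨fun _ hb => h.1 _ (hA hb), fun e he =>
    (h.2 e he).comp (hG.mono fun _ hc => hc.1) fun _ hc => ⟨hA hc.1, hc.2⟩⟩

end AlongComp

noncomputable section Compositions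

namespace BundleGerbe

open CstarBundle

variable {EM : Type u} [NormedAddCommGroup EM] [NormedSpace ℝ EM] {M : Type u}
    [TopologicalSpace M] [ChartedSpace EM M]

section

variable {P Q : BundleGerbe EM M} {f g : Morphism P Q}

/-- The point of `Q` over `(f x, g x)` given by a point of `D_{f,g}`. -/
def dval (a : DescendTot (descentIso f g)) (x : P.X) (h : P.π x = a.base) : Q.P.Tot :=
  (a.val ⟨x, h⟩).1.2

theorem proj_dval (a : DescendTot (descentIso f g)) (x : P.X) (h : P.π x = a.base) :
    Q.P.proj (dval a x h) = pairMap f g x :=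
  (a.val ⟨x, h⟩).2.2.trans (congrArg (pairMap f g) (a.proj_val ⟨x, h⟩))

theorem matches_dval (a : DescendTot (descentIso f g)) {x₁ x₂ : P.X} (h₁ : P.π x₁ = a.base)
    (h₂ : P.π x₂ = a.base) (p : P.P.Tot) (hp : P.P.proj p = (x₁, x₂)) :
    Matches f g p (dval a x₂ h₂) (dval a x₁ h₁) := by
  have hx : P.π x₁ = P.π ((Dhat f g).proj (a.val ⟨x₂, h₂⟩)) := by rw [a.proj_val, h₁, h₂]
  have h := matches_descentFun (f := f) (g := g)
    ⟨((x₁, (Dhat f g).proj (a.val ⟨x₂, h₂⟩)), a.val ⟨x₂, h₂⟩), hx, rfl⟩ p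
    (hp.trans (Prod.ext rfl (a.proj_val ⟨x₂, h₂⟩).symm))
  have e : (descentApp (descentHom f g) x₁ (a.val ⟨x₂, h₂⟩) hx) = a.val ⟨x₁, h₁⟩ :=
    a.compat ⟨x₁, h₁⟩ ⟨x₂, h₂⟩
  have e' : (descentApp (descentHom f g) x₁ (a.val ⟨x₂, h₂⟩) hx).1.2 = dval a x₁ h₁ :=
    congrArg (fun y => y.1.2) e
  rw [← e']
  exact h

theorem dval_congr {a b : DescendTot (descentIso f g)} (h : a = b) (x : P.X) (ha : P.π x = a.base)
    (hb : P.π x = b.base) : dval a x ha = dval b x hb := by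
  subst h; rfl

theorem dval_ext {a b : DescendTot (descentIso f g)} (h : a.base = b.base)
    (hv : ∀ x ha hb, dval a x ha = dval b x hb) : a = b :=
  DescendTot.ext h fun x ha hb =>
    Dhat_ext ((a.proj_val _).trans (b.proj_val ⟨x, hb⟩).symm) (hv x ha hb)

/-- A point of `D_{f,g}` is a family of points of `Q`, matched by the descent isomorphism. -/
def mkD (m : M) (v : ∀ x, P.π x = m → Q.P.Tot) (hv : ∀ x h, Q.P.proj (v x h) = pairMap f g x)
    (hm : ∀ x₁ x₂ h₁ h₂ p, P.P.proj p = (x₁, x₂) → Matches f g p (v x₂ h₂) (v x₁ h₁)) :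
    DescendTot (descentIso f g) where
  base := m
  val x := ⟨(x.1, v x.1 x.2), Set.mem_univ _, hv x.1 x.2⟩
  proj_val _ := rfl
  compat x₁ x₂ := by
    have hx : P.π x₁.1 = P.π x₂.1 := x₁.2.trans x₂.2.symm
    obtain ⟨p, hp⟩ := P.P.exists_over (b := (x₁.1, x₂.1)) hx
    let y : (Dhat f g).Tot := ⟨(x₂.1, v x₂.1 x₂.2), Set.mem_univ _, hv x₂.1 x₂.2⟩
    have h := matches_descentFun (f := f) (g := g) ⟨((x₁.1, x₂.1), y), hx, rfl⟩ p hp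
    refine Dhat_ext (proj_descentApp (descentHom f g) x₁.1 y hx) (h.unique (hm _ _ x₁.2 x₂.2 p hp) ?_)
    exact (descentApp (descentHom f g) x₁.1 y hx).2.2.trans
      ((congrArg (pairMap f g) (proj_descentApp (descentHom f g) x₁.1 y hx)).trans
        (hv x₁.1 x₁.2).symm)

theorem dval_mkD (m : M) (v : ∀ x, P.π x = m → Q.P.Tot) (hv hm) (x : P.X) (h : P.π x = m) :
    dval (mkD (f := f) (g := g) m v hv hm) x h = v x h := rfl

theorem dval_smul (z : ℂˣ) (a : DescendTot (descentIso f g)) (x : P.X) (h : P.π x = a.base) :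
    dval (z • a) x h = z • dval a x h := rfl

theorem exists_lift {e : Set M × (M → (D f g).Tot)} (he : e ∈ (D f g).atlas) :
    ∃ l : P.X → Q.P.Tot, (∀ x, P.π x ∈ e.1 → ∀ h, l x = dval (e.2 (P.π x)) x h) ∧
      Q.P.SmoothAlong 𝓘(ℝ, P.E) (P.π ⁻¹' e.1) (pairMap f g) l := by
  obtain ⟨-, -, l, hl, hs⟩ := he
  have h0 : (Dhat f g).SmoothAlong 𝓘(ℝ, P.E) (P.π ⁻¹' e.1) id l := hs
  exact ⟨fun x => (l x).1.2, fun x hx h => congrArg (fun y => y.1.2) (hl x hx h),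
    smoothAlong_of_pullback h0⟩

theorem mem_atlas_of_lift {e : Set M × (M → (D f g).Tot)} (ho : IsOpen e.1)
    (hb : ∀ m ∈ e.1, DescendTot.base (e.2 m) = m) (l : P.X → Q.P.Tot)
    (hl : ∀ x, P.π x ∈ e.1 → ∀ h, l x = dval (e.2 (P.π x)) x h)
    (hs : Q.P.SmoothAlong 𝓘(ℝ, P.E) (P.π ⁻¹' e.1) (pairMap f g) l) : e ∈ (D f g).atlas := by
  classical
  let l' : P.X → (Dhat f g).Tot := fun x =>
    if h : Q.P.proj (l x) = pairMap f g x then ⟨(x, l x), Set.mem_univ _, h⟩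
    else ((Dhat f g).exists_over (Set.mem_univ x)).choose
  have hl' : ∀ x, ∀ h : Q.P.proj (l x) = pairMap f g x, l' x = ⟨(x, l x), Set.mem_univ _, h⟩ :=
    fun x h => dif_pos h
  have hp : ∀ x, P.π x ∈ e.1 → (l' x).1.1 = x := fun x hx => by rw [hl' x (hs.1 x hx)]
  have hq : ∀ x, P.π x ∈ e.1 → (l' x).1.2 = l x := fun x hx => by rw [hl' x (hs.1 x hx)]
  refine ⟨ho, hb, l', fun x hx h => ?_, ?_⟩
  · refine Dhat_ext ((hp x hx).trans (DescendTot.proj_val _ ⟨x, h⟩).symm) ?_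
    exact (hq x hx).trans (hl x hx h)
  · have h1 : Q.P.SmoothAlong 𝓘(ℝ, P.E) (P.π ⁻¹' e.1) (pairMap f g) (fun x => (l' x).1.2) :=
      ⟨fun x hx => (congrArg Q.P.proj (hq x hx)).trans (hs.1 x hx), fun k hk =>
        (hs.2 k hk).congr_left fun x hx => hq x hx.1⟩
    exact smoothAlong_pullback (F := id) hp h1

end

section vertical

variable {P Q : BundleGerbe EM M} {f₁ f₂ f₃ : Morphism P Q}

theorem Matches.mul {p : P.P.Tot} {a a' b b' : Q.P.Tot} (ha : Matches f₂ f₃ p a a')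
    (hb : Matches f₁ f₂ p b b') (h : (Q.P.proj a).1 = (Q.P.proj b).2)
    (h' : (Q.P.proj a').1 = (Q.P.proj b').2) :
    Matches f₁ f₃ p (Q.mul a b h) (Q.mul a' b' h') := by
  obtain ⟨h1, h2, e⟩ := ha
  obtain ⟨h3, h4, e'⟩ := hb
  refine ⟨by rw [ProductMap.proj_app]; exact h3, by rw [ProductMap.proj_app]; exact h2, ?_⟩
  calc Q.mul (Q.mul a b h) (f₁.fhat.toFun p) _
      = Q.mul a (Q.mul b (f₁.fhat.toFun p) h3) (by rw [ProductMap.proj_app]; exact h) :=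
        (Q.assoc _ _ _ h h3).symm
    _ = Q.mul a (Q.mul (f₂.fhat.toFun p) b' h4) (by rw [ProductMap.proj_app]; exact h1) :=
        mul_congr rfl e' _
    _ = Q.mul (Q.mul a (f₂.fhat.toFun p) h1) b' (by rw [ProductMap.proj_app]; exact h4) :=
        Q.assoc _ _ _ h1 h4
    _ = Q.mul (Q.mul (f₃.fhat.toFun p) a' h2) b' (by rw [ProductMap.proj_app]; exact h') :=
        mul_congr e rfl _
    _ = Q.mul (f₃.fhat.toFun p) (Q.mul a' b' h') _ := (Q.assoc _ _ _ h2 h').symm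

theorem proj_dval_mul (a : DescendTot (descentIso f₂ f₃)) (b : DescendTot (descentIso f₁ f₂))
    (x : P.X) (ha : P.π x = a.base) (hb : P.π x = b.base) :
    (Q.P.proj (dval a x ha)).1 = (Q.P.proj (dval b x hb)).2 := by
  rw [proj_dval, proj_dval]; rfl

/-- The product `m(ξ₂₃ ⊗ ξ₁₂)` at all points of a fibre of `X → M`. -/
def vcompFun (a : DescendTot (descentIso f₂ f₃)) (b : DescendTot (descentIso f₁ f₂))
    (h : a.base = b.base) : DescendTot (descentIso f₁ f₃) :=
  mkD a.base
    (fun x hx => Q.mul (dval a x hx) (dval b x (hx.trans h)) (proj_dval_mul a b x _ _))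
    (fun x hx => by rw [ProductMap.proj_app, proj_dval, proj_dval]; rfl)
    (fun _ _ h₁ h₂ p hp => (matches_dval a h₁ h₂ p hp).mul
      (matches_dval b (h₁.trans h) (h₂.trans h) p hp) _ _)

/-- The map of total spaces `ξ₂₃ ⊗ ξ₁₂ ↦ m(ξ₂₃ ⊗ ξ₁₂)`. -/
def vcompTot : ((D f₂ f₃).tensor (D f₁ f₂)).Tot → (D f₁ f₃).Tot :=
  Quotient.lift (fun x => vcompFun x.1.1 x.1.2 x.2) (by
    rintro ⟨⟨a, b⟩, h⟩ ⟨⟨a', b'⟩, h'⟩ ⟨z, hz, hz'⟩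
    have ea : a' = z • a := hz
    have eb : b' = z⁻¹ • b := hz'
    subst ea; subst eb
    refine dval_ext rfl fun x hx hx' => ?_
    refine Eq.symm ((mul_smul_smul (G := Q) (z := z) (z' := z⁻¹) (p := dval a x hx)
      (q := dval b x (hx.trans h)) ?_ (proj_dval_mul a b x _ _)).trans ?_)
    · rw [Q.P.proj_smul, Q.P.proj_smul]; exact proj_dval_mul a b x _ _
    · rw [mul_inv_cancel, one_smul]; rfl)

theorem vcompTot_mem_atlas {e : Set M × (M → ((D f₂ f₃).tensor (D f₁ f₂)).Tot)}
    (he : e ∈ ((D f₂ f₃).tensor (D f₁ f₂)).atlas) :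
    ((e.1, fun m => vcompTot (e.2 m)) : Set M × (M → (D f₁ f₃).Tot)) ∈ (D f₁ f₃).atlas := by
  classical
  have ho := ((D f₂ f₃).tensor (D f₁ f₂)).isOpen_source e he
  obtain ⟨e₁, he₁, e₂, he₂, h, h'⟩ := he
  obtain ⟨l₁, hl₁, hs₁⟩ := exists_lift he₁
  obtain ⟨l₂, hl₂, hs₂⟩ := exists_lift he₂
  have hm₁ : ∀ m ∈ e.1, m ∈ e₁.1 := fun m hm => by rw [h] at hm; exact hm.1
  have hm₂ : ∀ m ∈ e.1, m ∈ e₂.1 := fun m hm => by rw [h] at hm; exact hm.2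
  have key : ∀ m ∈ e.1, ∃ k, vcompTot (e.2 m) = vcompFun (e₁.2 m) (e₂.2 m) k := fun m hm => by
    obtain ⟨k, hk⟩ := h' m ⟨hm, Set.mem_univ _⟩
    exact ⟨k, congrArg vcompTot hk⟩
  have b₁ : ∀ m ∈ e.1, DescendTot.base (e₁.2 m) = m := fun m hm =>
    (D f₂ f₃).proj_section e₁ he₁ m ⟨hm₁ m hm, Set.mem_univ _⟩
  have b₂ : ∀ m ∈ e.1, DescendTot.base (e₂.2 m) = m := fun m hm =>
    (D f₁ f₂).proj_section e₂ he₂ m ⟨hm₂ m hm, Set.mem_univ _⟩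
  have hk : ∀ x, P.π x ∈ e.1 → (Q.P.proj (l₁ x)).1 = (Q.P.proj (l₂ x)).2 := fun x hx => by
    rw [hs₁.1 x (hm₁ _ hx), hs₂.1 x (hm₂ _ hx)]; rfl
  let l : P.X → Q.P.Tot := fun x =>
    if hx : (Q.P.proj (l₁ x)).1 = (Q.P.proj (l₂ x)).2 then Q.mul (l₁ x) (l₂ x) hx else l₁ x
  refine mem_atlas_of_lift ho (fun m hm => ?_) l (fun x hx hh => ?_) ?_
  · obtain ⟨k, hk⟩ := key m hm
    exact (congrArg DescendTot.base hk).trans (b₁ m hm)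
  · obtain ⟨k, hk'⟩ := key _ hx
    have q₁ := hl₁ x (hm₁ _ hx) (b₁ _ hx).symm
    have q₂ := hl₂ x (hm₂ _ hx) (b₂ _ hx).symm
    refine Eq.trans ?_ (dval_congr hk' x hh (b₁ _ hx).symm).symm
    exact (dif_pos (hk x hx)).trans (mul_congr q₁ q₂ _)
  · exact smoothAlong_mul (a := f₁.f) (b := f₂.f) (c := f₃.f) f₁.contMDiff_f.contMDiffOn
      f₂.contMDiff_f.contMDiffOn f₃.contMDiff_f.contMDiffOn (hs₁.mono fun x hx => hm₁ _ hx)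
      (hs₂.mono fun x hx => hm₂ _ hx) fun x hx hh => dif_pos hh

variable (f₁ f₂ f₃) in
/-- The isomorphism `D_{f₂,f₃} ⊗ D_{f₁,f₂} → D_{f₁,f₃}` induced by the bundle gerbe product of
`Q`. -/
def vcompHom : Hom ((D f₂ f₃).tensor (D f₁ f₂)) (D f₁ f₃) where
  toFun := vcompTot
  proj_toFun := by rintro ⟨x⟩; rfl
  map_smul := by
    rintro z ⟨⟨a, b⟩, h⟩
    refine dval_ext rfl fun x hx _ => ?_
    exact ProductMap.smul_app Q.m z (dval a x hx) (dval b x (hx.trans h)) (by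
      rw [Q.P.proj_smul]; exact proj_dval_mul a b x _ _)
  smooth e he e' he' := (D f₁ f₃).transition _ (vcompTot_mem_atlas he) e' he'

/-- Composition of transformations `θ₂₃ : f₂ ⇒ f₃` and `θ₁₂ : f₁ ⇒ f₂`: the section `θ₂₃ ⊗ θ₁₂` of
`D_{f₂,f₃} ⊗ D_{f₁,f₂} ≅ D_{f₁,f₃}`. -/
def Transformation.vcomp (θ₂₃ : Transformation f₂ f₃) (θ₁₂ : Transformation f₁ f₂) :
    Transformation f₁ f₃ :=
  (θ₂₃.tensor θ₁₂).map (vcompHom f₁ f₂ f₃)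

end vertical

section horizontal

variable {P Q R : BundleGerbe EM M} {f₁ f₂ : Morphism P Q} {g₁ g₂ : Morphism Q R}

theorem hcomp_proj (a : Q.P.Tot) (b : R.P.Tot) (x : P.X) (ha : Q.P.proj a = pairMap f₁ f₂ x)
    (hb : R.P.proj b = pairMap g₁ g₂ (f₁.f x)) :
    (R.P.proj (g₂.fhat.toFun a)).1 = (R.P.proj b).2 := by
  rw [g₂.fhat.proj_toFun, ha, hb]; rfl

theorem Matches.hmul {p : P.P.Tot} {a a' : Q.P.Tot} {b b' : R.P.Tot} (ha : Matches f₁ f₂ p a a')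
    (hb : Matches g₁ g₂ (f₁.fhat.toFun p) b b')
    (h : (R.P.proj (g₂.fhat.toFun a)).1 = (R.P.proj b).2)
    (h' : (R.P.proj (g₂.fhat.toFun a')).1 = (R.P.proj b').2) :
    Matches (g₁.comp f₁) (g₂.comp f₂) p (R.mul (g₂.fhat.toFun a) b h)
      (R.mul (g₂.fhat.toFun a') b' h') := by
  obtain ⟨h1, h2, e⟩ := ha
  obtain ⟨h3, h4, e'⟩ := hb
  have k1 : (R.P.proj (g₂.fhat.toFun a)).1 =
      (R.P.proj (g₂.fhat.toFun (f₁.fhat.toFun p))).2 := by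
    rw [g₂.fhat.proj_toFun, g₂.fhat.proj_toFun]; exact congrArg g₂.f h1
  have k2 : (R.P.proj (g₂.fhat.toFun (f₂.fhat.toFun p))).1 =
      (R.P.proj (g₂.fhat.toFun a')).2 := by
    rw [g₂.fhat.proj_toFun, g₂.fhat.proj_toFun]; exact congrArg g₂.f h2
  refine ⟨by rw [ProductMap.proj_app]; exact h3, by rw [ProductMap.proj_app]; exact k2, ?_⟩
  change R.mul (R.mul (g₂.fhat.toFun a) b h) (g₁.fhat.toFun (f₁.fhat.toFun p)) _ =
    R.mul (g₂.fhat.toFun (f₂.fhat.toFun p)) (R.mul (g₂.fhat.toFun a') b' h') _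
  calc R.mul (R.mul (g₂.fhat.toFun a) b h) (g₁.fhat.toFun (f₁.fhat.toFun p)) _
      = R.mul (g₂.fhat.toFun a) (R.mul b (g₁.fhat.toFun (f₁.fhat.toFun p)) h3)
          (by rw [ProductMap.proj_app]; exact h) := (R.assoc _ _ _ h h3).symm
    _ = R.mul (g₂.fhat.toFun a) (R.mul (g₂.fhat.toFun (f₁.fhat.toFun p)) b' h4)
          (by rw [ProductMap.proj_app]; exact k1) := mul_congr rfl e' _
    _ = R.mul (R.mul (g₂.fhat.toFun a) (g₂.fhat.toFun (f₁.fhat.toFun p)) k1) b'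
          (by rw [ProductMap.proj_app]; exact h4) := R.assoc _ _ _ k1 h4
    _ = R.mul (R.mul (g₂.fhat.toFun (f₂.fhat.toFun p)) (g₂.fhat.toFun a') k2) b'
          (by rw [ProductMap.proj_app]; exact h') := by
        refine mul_congr ?_ rfl _
        exact (g₂.map_mul _ _ h1).symm.trans ((congrArg g₂.fhat.toFun e).trans (g₂.map_mul _ _ h2))
    _ = R.mul (g₂.fhat.toFun (f₂.fhat.toFun p)) (R.mul (g₂.fhat.toFun a') b' h') _ :=
        (R.assoc _ _ _ k2 h').symm

/-- The product `m(ĝ₂(ξ) ⊗ ζ)` at all points `x` of a fibre of `X → M`, where `ξ` lies over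
`(f₁ x, f₂ x)` and `ζ` over `(g₁ (f₁ x), g₂ (f₁ x))`. -/
def hcompFun (a : DescendTot (descentIso f₁ f₂)) (b : DescendTot (descentIso g₁ g₂))
    (h : a.base = b.base) : DescendTot (descentIso (g₁.comp f₁) (g₂.comp f₂)) :=
  mkD a.base
    (fun x hx => R.mul (g₂.fhat.toFun (dval a x hx))
      (dval b (f₁.f x) ((f₁.π_f x).trans (hx.trans h)))
      (hcomp_proj (f₁ := f₁) (f₂ := f₂) (g₁ := g₁) _ _ x (proj_dval _ _ _) (proj_dval _ _ _)))
    (fun x hx => by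
      rw [ProductMap.proj_app, g₂.fhat.proj_toFun, proj_dval, proj_dval]; rfl)
    (fun x₁ x₂ h₁ h₂ p hp => (matches_dval a h₁ h₂ p hp).hmul
      (matches_dval b _ _ (f₁.fhat.toFun p) (fhat_proj_of hp)) _ _)

/-- The map of total spaces `ξ ⊗ ζ ↦ m(ĝ₂(ξ) ⊗ ζ)`. -/
def hcompTot : ((D f₁ f₂).tensor (D g₁ g₂)).Tot → (D (g₁.comp f₁) (g₂.comp f₂)).Tot :=
  Quotient.lift (fun x => hcompFun x.1.1 x.1.2 x.2) (by
    rintro ⟨⟨a, b⟩, h⟩ ⟨⟨a', b'⟩, h'⟩ ⟨z, hz, hz'⟩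
    have ea : a' = z • a := hz
    have eb : b' = z⁻¹ • b := hz'
    subst ea; subst eb
    refine dval_ext rfl fun x hx hx' => ?_
    have hb := (f₁.π_f x).trans (hx.trans h)
    have hh := hcomp_proj (f₁ := f₁) (f₂ := f₂) (g₁ := g₁) (g₂ := g₂) (dval a x hx)
      (dval b (f₁.f x) hb) x (proj_dval _ _ _) (proj_dval _ _ _)
    have hh' : (R.P.proj (z • g₂.fhat.toFun (dval a x hx))).1 =
        (R.P.proj (z⁻¹ • dval b (f₁.f x) hb)).2 := by
      rw [R.P.proj_smul, R.P.proj_smul]; exact hh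
    have e1 := mul_smul_smul (G := R) (z := z) (z' := z⁻¹) hh' hh
    rw [mul_inv_cancel, one_smul] at e1
    exact e1.symm.trans (mul_congr (g₂.fhat.map_smul z _).symm rfl hh'))

theorem hcompTot_mem_atlas {e : Set M × (M → ((D f₁ f₂).tensor (D g₁ g₂)).Tot)}
    (he : e ∈ ((D f₁ f₂).tensor (D g₁ g₂)).atlas) :
    ((e.1, fun m => hcompTot (e.2 m)) : Set M × (M → (D (g₁.comp f₁) (g₂.comp f₂)).Tot)) ∈
      (D (g₁.comp f₁) (g₂.comp f₂)).atlas := by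
  classical
  have ho := ((D f₁ f₂).tensor (D g₁ g₂)).isOpen_source e he
  obtain ⟨e₁, he₁, e₂, he₂, h, h'⟩ := he
  obtain ⟨l₁, hl₁, hs₁⟩ := exists_lift he₁
  obtain ⟨l₂, hl₂, hs₂⟩ := exists_lift he₂
  have hm₁ : ∀ m ∈ e.1, m ∈ e₁.1 := fun m hm => by rw [h] at hm; exact hm.1
  have hm₂ : ∀ m ∈ e.1, m ∈ e₂.1 := fun m hm => by rw [h] at hm; exact hm.2
  have hf : ∀ x, P.π x ∈ e.1 → Q.π (f₁.f x) ∈ e₂.1 := fun x hx => by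
    rw [f₁.π_f]; exact hm₂ _ hx
  have key : ∀ m ∈ e.1, ∃ k, hcompTot (e.2 m) = hcompFun (e₁.2 m) (e₂.2 m) k := fun m hm => by
    obtain ⟨k, hk⟩ := h' m ⟨hm, Set.mem_univ _⟩
    exact ⟨k, congrArg hcompTot hk⟩
  have b₁ : ∀ m ∈ e.1, DescendTot.base (e₁.2 m) = m := fun m hm =>
    (D f₁ f₂).proj_section e₁ he₁ m ⟨hm₁ m hm, Set.mem_univ _⟩
  have b₂ : ∀ m ∈ e₂.1, DescendTot.base (e₂.2 m) = m := fun m hm =>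
    (D g₁ g₂).proj_section e₂ he₂ m ⟨hm, Set.mem_univ _⟩
  have hs₁' : R.P.SmoothAlong 𝓘(ℝ, P.E) (P.π ⁻¹' e.1) (fun x => (g₂.f (f₁.f x), g₂.f (f₂.f x)))
      (fun x => g₂.fhat.toFun (l₁ x)) :=
    HomOver.smoothAlong (g₂.contMDiff_f.prodMap g₂.contMDiff_f) g₂.fhat
      (contMDiff_pairMap f₁ f₂).contMDiffOn (hs₁.mono fun x hx => hm₁ _ hx)
  have hs₂' : R.P.SmoothAlong 𝓘(ℝ, P.E) (P.π ⁻¹' e.1) (fun x => (g₁.f (f₁.f x), g₂.f (f₁.f x)))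
      (fun x => l₂ (f₁.f x)) := hs₂.comp_right f₁.contMDiff_f.contMDiffOn hf
  have hk : ∀ x, P.π x ∈ e.1 →
      (R.P.proj (g₂.fhat.toFun (l₁ x))).1 = (R.P.proj (l₂ (f₁.f x))).2 := fun x hx => by
    rw [hs₁'.1 x hx, hs₂'.1 x hx]
  let l : P.X → R.P.Tot := fun x =>
    if hx : (R.P.proj (g₂.fhat.toFun (l₁ x))).1 = (R.P.proj (l₂ (f₁.f x))).2 then
      R.mul (g₂.fhat.toFun (l₁ x)) (l₂ (f₁.f x)) hx else g₂.fhat.toFun (l₁ x)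
  refine mem_atlas_of_lift ho (fun m hm => ?_) l (fun x hx hh => ?_) ?_
  · obtain ⟨k, hk⟩ := key m hm
    exact (congrArg DescendTot.base hk).trans (b₁ m hm)
  · obtain ⟨k, hk'⟩ := key _ hx
    have q₁ := hl₁ x (hm₁ _ hx) (b₁ _ hx).symm
    have q₂ := hl₂ (f₁.f x) (hf x hx) (b₂ _ (hf x hx)).symm
    have q₃ := dval_congr (congrArg e₂.2 (f₁.π_f x)) (f₁.f x) (b₂ _ (hf x hx)).symm
      ((f₁.π_f x).trans (b₂ _ (hm₂ _ hx)).symm)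
    refine Eq.trans ?_ (dval_congr hk' x hh (b₁ _ hx).symm).symm
    exact (dif_pos (hk x hx)).trans (mul_congr (congrArg g₂.fhat.toFun q₁) (q₂.trans q₃) _)
  · exact smoothAlong_mul (a := fun x => g₁.f (f₁.f x)) (b := fun x => g₂.f (f₁.f x))
      (c := fun x => g₂.f (f₂.f x)) (g₁.contMDiff_f.comp f₁.contMDiff_f).contMDiffOn
      (g₂.contMDiff_f.comp f₁.contMDiff_f).contMDiffOn
      (g₂.contMDiff_f.comp f₂.contMDiff_f).contMDiffOn hs₁' hs₂' fun x hx hh => dif_pos hh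

variable (f₁ f₂ g₁ g₂) in
/-- The isomorphism `D_{f₁,f₂} ⊗ D_{g₁,g₂} → D_{g₁∘f₁,g₂∘f₂}`, induced by
`(f₁, f₂)⁻¹Q ≅ (f₁, f₂)⁻¹(g₂ × g₂)⁻¹R` and the bundle gerbe product of `R`. -/
def hcompHom : Hom ((D f₁ f₂).tensor (D g₁ g₂)) (D (g₁.comp f₁) (g₂.comp f₂)) where
  toFun := hcompTot
  proj_toFun := by rintro ⟨x⟩; rfl
  map_smul := by
    rintro z ⟨⟨a, b⟩, h⟩
    refine dval_ext rfl fun x hx _ => ?_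
    have hb := (f₁.π_f x).trans (hx.trans h)
    have hh := hcomp_proj (f₁ := f₁) (f₂ := f₂) (g₁ := g₁) (g₂ := g₂) (dval a x hx)
      (dval b (f₁.f x) hb) x (proj_dval _ _ _) (proj_dval _ _ _)
    have hh' : (R.P.proj (z • g₂.fhat.toFun (dval a x hx))).1 =
        (R.P.proj (dval b (f₁.f x) hb)).2 := by
      rw [R.P.proj_smul]; exact hh
    exact (mul_congr (g₂.fhat.map_smul z (dval a x hx)).symm rfl hh').symm.trans
      (ProductMap.smul_app R.m z _ _ hh')
  smooth e he e' he' := (D (g₁.comp f₁) (g₂.comp f₂)).transition _ (hcompTot_mem_atlas he) e' he'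

/-- Horizontal composition of transformations `ζ : g₁ ⇒ g₂` and `θ : f₁ ⇒ f₂`: the section `θ ⊗ ζ`
of `D_{f₁,f₂} ⊗ D_{g₁,g₂} ≅ D_{g₁∘f₁,g₂∘f₂}`. -/
def Transformation.hcomp (ζ : Transformation g₁ g₂) (θ : Transformation f₁ f₂) :
    Transformation (g₁.comp f₁) (g₂.comp f₂) :=
  (θ.tensor ζ).map (hcompHom f₁ f₂ g₁ g₂)

end horizontal

end BundleGerbe

end Compositions

noncomputable section TwoCategories

open CategoryTheory

universe v₁ v₂ v₃

/-- The operations of a 2-category with objects `Ob`: 1-arrows and 2-arrows, identity 1-arrows and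
composition of 1-arrows, vertical and horizontal composition of 2-arrows, all written in the order
of maps. (The identity 2-arrows are determined by the vertical composition.) -/
structure TwoCategoryData (Ob : Type v₃) where
  Arrow : Ob → Ob → Type v₂
  TwoArrow : ∀ {a b : Ob}, Arrow a b → Arrow a b → Type v₁
  id₁ : ∀ a : Ob, Arrow a a
  comp₁ : ∀ {a b c : Ob}, Arrow b c → Arrow a b → Arrow a c
  vcomp : ∀ {a b : Ob} {f₁ f₂ f₃ : Arrow a b}, TwoArrow f₂ f₃ → TwoArrow f₁ f₂ → TwoArrow f₁ f₃
  hcomp : ∀ {a b c : Ob} {f₁ f₂ : Arrow a b} {g₁ g₂ : Arrow b c},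
    TwoArrow g₁ g₂ → TwoArrow f₁ f₂ → TwoArrow (comp₁ g₁ f₁) (comp₁ g₂ f₂)

/-- The operations of a bicategory. -/
def TwoCategoryData.ofBicategory (Ob : Type v₃) [Bicategory.{v₁, v₂} Ob] :
    TwoCategoryData.{v₁, v₂, v₃} Ob where
  Arrow a b := a ⟶ b
  TwoArrow f g := f ⟶ g
  id₁ a := 𝟙 a
  comp₁ g f := f ≫ g
  vcomp η θ := θ ≫ η
  hcomp {_ _ _ _ f₂ g₁ _} η θ := Bicategory.whiskerRight θ g₁ ≫ Bicategory.whiskerLeft f₂ η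

/-- Bundle gerbes on `M`, bundle gerbe morphisms and transformations. -/
def BundleGerbe.twoCategoryData (EM : Type u) [NormedAddCommGroup EM] [NormedSpace ℝ EM]
    (M : Type u) [TopologicalSpace M] [ChartedSpace EM M] :
    TwoCategoryData.{u, u, u + 1} (BundleGerbe EM M) where
  Arrow := BundleGerbe.Morphism
  TwoArrow := BundleGerbe.Transformation
  id₁ := BundleGerbe.Morphism.id
  comp₁ := BundleGerbe.Morphism.comp
  vcomp := BundleGerbe.Transformation.vcomp
  hcomp := BundleGerbe.Transformation.hcomp

end TwoCategories

end CstarGerbe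

noncomputable section

open CategoryTheory

namespace CstarGerbe.BundleGerbe

open CstarBundle

variable {EM : Type u} [NormedAddCommGroup EM] [NormedSpace ℝ EM] {M : Type u}
  [TopologicalSpace M] [ChartedSpace EM M]

/-! ### Units of the bundle gerbe product -/

section units

variable {G : BundleGerbe EM M}

/-! A bundle gerbe is a category in disguise. Its objects are the points of `X`, a point of `P` over
`(x₁, x₂)` is an arrow `x₁ → x₂`, and `m(u ⊗ v)` is "`u` after `v`". Identity arrows are not part of
the data, but they are forced: `ℂˣ` acts simply transitively on the fibre over `(y, y)` and the
product is bilinear, so this fibre contains exactly one idempotent (`exists_idempotent`,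
`eq_unit_of_idempotent`), and by cancellation it is neutral on both sides (`unit_mul`, `mul_unit`).

In this picture a bundle gerbe morphism is a functor (`Morphism.map_unit`), and a transformation is
a smooth natural transformation: compatibility with the descent isomorphism `φ` is the naturality
square `θ(x₂) f̂(p) = ĝ(p) θ(x₁)` for `p : x₁ → x₂` (`matches_value`). Vertical composition composes
the components, and horizontal composition is the usual one, `ĝ₂(θ(x)) ζ(f₁ x)`. The theorem thus
follows the classical proof that categories, functors and natural transformations form a strict
2-category. Smoothness is already built into the two compositions, so it has to be checked only for
the identity transformations (`smoothAlong_unit`).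

Every equation between transformations is tested on components (`ext_value`), which are given by
`value_vcomp` and `value_hcomp`. The vertical laws are associativity and the unit laws in `Q`. The
interchange law is naturality of `ζ` at the arrow `θ(x)` (`hcomp_eq_vcomp`). Horizontal
associativity combines multiplicativity of `ĥ₂` with associativity in the last gerbe
(`hcomp_assoc`). Composition of morphisms is associative and unital by definitional equality, so
identities can serve as associators and unitors, and coherence reduces to whiskered identities being
identities.

The bicategory is built from whiskerings, that is, horizontal compositions with identity
transformations; `ofBicategory_bicategory` recovers from them the prescribed horizontal composition.
-/

theorem exists_idempotent (y : G.X) :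
    ∃ e : G.P.Tot, ∃ he : G.P.proj e = (y, y), G.mul e e (by rw [he]) = e := by
  obtain ⟨p, hp⟩ := G.P.exists_over (b := (y, y)) (show G.π y = G.π y from rfl)
  obtain ⟨z, hz⟩ := G.P.transitive (G.mul p p (by rw [hp])) p (by rw [ProductMap.proj_app, hp])
  -- If `p p = z p`, then `(c p)(c p) = c² z p`, which equals `c p` exactly when `c = z⁻¹`.
  refine ⟨z⁻¹ • p, (G.P.proj_smul _ _).trans hp, ?_⟩
  rw [mul_smul_smul _ (by rw [hp]), hz, ← mul_smul, inv_mul_cancel_right]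

/-- The unit of the bundle gerbe product over `(y, y)`. -/
def unit (G : BundleGerbe EM M) (y : G.X) : G.P.Tot :=
  (exists_idempotent y).choose

theorem proj_unit (y : G.X) : G.P.proj (G.unit y) = (y, y) :=
  (exists_idempotent y).choose_spec.choose

theorem unit_mul_unit (y : G.X) :
    G.mul (G.unit y) (G.unit y) (by rw [proj_unit]) = G.unit y :=
  (exists_idempotent y).choose_spec.choose_spec

theorem unit_mul {y : G.X} (u : G.P.Tot) (h : (G.P.proj (G.unit y)).1 = (G.P.proj u).2) :
    G.mul (G.unit y) u h = u := by
  have hy : (G.P.proj u).2 = y := by rw [← h, proj_unit]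
  have hp : G.P.proj (G.mul (G.unit y) u h) = G.P.proj u := by
    rw [ProductMap.proj_app, proj_unit]; exact Prod.ext rfl hy.symm
  -- With `e` the unit, `e (e u) = (e e) u = e u`; cancelling the left factor `e` leaves `e u = u`.
  refine mul_right_cancel (u := G.unit y) (h := by rw [hp]; exact h) (h' := h) hp ?_
  rw [mul, G.assoc _ _ _ (by rw [proj_unit]) h]
  exact mul_congr (unit_mul_unit y) rfl _

theorem mul_unit {y : G.X} (u : G.P.Tot) (h : (G.P.proj u).1 = (G.P.proj (G.unit y)).2) :
    G.mul u (G.unit y) h = u := by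
  have hy : (G.P.proj u).1 = y := by rw [h, proj_unit]
  have hp : G.P.proj (G.mul u (G.unit y) h) = G.P.proj u := by
    rw [ProductMap.proj_app, proj_unit]; exact Prod.ext hy.symm rfl
  refine mul_left_cancel (v := G.unit y) (h := by rw [hp]; exact h) (h' := h) hp ?_
  rw [mul, ← G.assoc _ _ _ h (by rw [proj_unit])]
  exact mul_congr rfl (unit_mul_unit y) _

/-- Cancel `u` in `u u = u = u e`, where `e` is the unit. This uniqueness makes the arbitrary choice
in `unit` canonical. -/
theorem eq_unit_of_idempotent {y : G.X} {u : G.P.Tot} (hu : G.P.proj u = (y, y))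
    (h : (G.P.proj u).1 = (G.P.proj u).2) (e : G.mul u u h = u) : u = G.unit y :=
  mul_right_cancel (h := h) (h' := by rw [hu, proj_unit]) (hu.trans (proj_unit y).symm)
    (e.trans (mul_unit u (by rw [hu, proj_unit])).symm)

/-- The units are chosen point by point, so smoothness cannot come from the choice. It comes from
division: a local section `s` of `P` satisfies `s e = s` along the diagonal, so `e` is the quotient
of `s` by itself, and quotients of smooth sections are smooth. -/
theorem smoothAlong_unit {E : Type u} [NormedAddCommGroup E] [NormedSpace ℝ E] {H : Type u}
    [TopologicalSpace H] {I : ModelWithCorners ℝ E H} {B : Type u} [TopologicalSpace B]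
    [ChartedSpace H B] {A : Set B} {a : B → G.X} (ha : ContMDiffOn I 𝓘(ℝ, G.E) ∞ a A) :
    G.P.SmoothAlong I A (fun x => (a x, a x)) fun x => G.unit (a x) := by
  refine SmoothAlong.of_cover fun x hx => ?_
  obtain ⟨e, he, U, hU, hxU, hUe⟩ := G.P.exists_chart_along (F := fun x => (a x, a x))
    (ha.prodMk ha) hx (show G.π (a x) = G.π (a x) from rfl)
  have hs : G.P.SmoothAlong I (A ∩ U) (fun x => (a x, a x)) fun x => e.2 (a x, a x) :=
    SmoothAlong.comp (G.P.isSmoothOn_atlas he) ((ha.prodMk ha).mono Set.inter_subset_left)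
      fun y hy => ⟨hUe hy, rfl⟩
  have ha' := ha.mono (Set.inter_subset_left (t := U))
  exact ⟨U, hU, hxU, smoothAlong_ldiv ha' ha' ha' hs hs (fun y _ => proj_unit _)
    fun y _ h => (mul_unit _ h).symm⟩

/-- A multiplicative map sends idempotents to idempotents, and the unit is the only idempotent in
its fibre. -/
theorem Morphism.map_unit {P Q : BundleGerbe EM M} (f : Morphism P Q) (x : P.X) :
    f.fhat.toFun (P.unit x) = Q.unit (f.f x) := by
  have hp : Q.P.proj (f.fhat.toFun (P.unit x)) = (f.f x, f.f x) := fhat_proj_of (proj_unit x)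
  refine eq_unit_of_idempotent hp (by rw [hp]) ?_
  rw [← f.map_mul _ _ (by rw [proj_unit]), unit_mul_unit]

end units

/-! ### Transformations as natural families of points, and the identity transformations -/

namespace Transformation

section

variable {P Q : BundleGerbe EM M} {f g : Morphism P Q}

/-- The point of `Q` over `(f x, g x)` given by a transformation `f ⇒ g`. -/
def value (θ : Transformation f g) (x : P.X) : Q.P.Tot :=
  dval (θ.toFun (P.π x)) x (θ.proj_toFun (P.π x)).symm

theorem proj_value (θ : Transformation f g) (x : P.X) :
    Q.P.proj (θ.value x) = (f.f x, g.f x) :=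
  proj_dval _ _ _

/-- As `θ.toFun m` lies over `m`, the hypothesis forces `m = π x`. The lemma absorbs the difference
between base points that are equal only by a proof, such as `Q.π (f x)` and `P.π x`. -/
theorem dval_eq_value (θ : Transformation f g) {m : M} (x : P.X)
    (h : P.π x = DescendTot.base (θ.toFun m)) : dval (θ.toFun m) x h = θ.value x := by
  have hm : m = P.π x := (θ.proj_toFun m).symm.trans h.symm
  subst hm
  rfl

/-- A point of the descended bundle over `m` is a family indexed by the fibre of `X` over `m`, so a
section on `M` is determined by its lift to `X`. All later equations of transformations are proved
in this way. -/
theorem ext_value {θ θ' : Transformation f g} (h : ∀ x, θ.value x = θ'.value x) : θ = θ' := by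
  refine GlobalSection.ext (funext fun m => ?_)
  refine dval_ext ((θ.proj_toFun m).trans (θ'.proj_toFun m).symm) fun x ha hb => ?_
  rw [dval_eq_value, dval_eq_value, h]

/-- This is naturality, `θ(x₂) f̂(p) = ĝ(p) θ(x₁)`: both values belong to one point of the descended
bundle, and its members correspond under `φ`, which may be tested on any `p`. -/
theorem matches_value (θ : Transformation f g) (p : P.P.Tot) {x₁ x₂ : P.X}
    (hp : P.P.proj p = (x₁, x₂)) : Matches f g p (θ.value x₂) (θ.value x₁) := by
  have hx : P.π x₁ = P.π x₂ := by
    have h := P.P.proj_mem p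
    rwa [hp] at h
  have h := matches_dval (θ.toFun (P.π x₂)) (hx.trans (θ.proj_toFun _).symm)
    (θ.proj_toFun _).symm p hp
  rwa [dval_eq_value θ x₁] at h

variable (f) in
/-- The identity transformation of `f`, given by the units over `(f x, f x)`. -/
def ident : Transformation f f where
  toFun m := mkD m (fun x _ => Q.unit (f.f x)) (fun x _ => proj_unit _)
    fun x₁ x₂ _ _ p hp => by
      have h := fhat_proj_of (f := f) hp
      have h₁ : (Q.P.proj (Q.unit (f.f x₂))).1 = (Q.P.proj (f.fhat.toFun p)).2 := by
        rw [h, proj_unit]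
      have h₂ : (Q.P.proj (f.fhat.toFun p)).1 = (Q.P.proj (Q.unit (f.f x₁))).2 := by
        rw [h, proj_unit]
      exact ⟨h₁, h₂, (unit_mul _ h₁).trans (mul_unit _ h₂).symm⟩
  smooth := by
    refine ⟨fun _ _ => rfl, fun e he => ?_⟩
    -- The lift `x ↦ unit (f x)` is smooth on all of `X`, so the section itself is a chart of `D f
    -- f` with domain `M`. Its smoothness in any other chart is then a transition function.
    refine ((D f f).transition (Set.univ, _) (mem_atlas_of_lift isOpen_univ (fun _ _ => rfl)
      (fun x => Q.unit (f.f x)) (fun _ _ _ => rfl)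
      (smoothAlong_unit f.contMDiff_f.contMDiffOn)) e he).mono fun m hm => ⟨hm, Set.mem_univ _⟩

@[simp]
theorem value_ident (x : P.X) : (ident f).value x = Q.unit (f.f x) := rfl

end

/-! ### Vertical composition -/

section

variable {P Q : BundleGerbe EM M} {f₁ f₂ f₃ f₄ : Morphism P Q}

theorem proj_value_vcomp (θ₂₃ : Transformation f₂ f₃) (θ₁₂ : Transformation f₁ f₂) (x : P.X) :
    (Q.P.proj (θ₂₃.value x)).1 = (Q.P.proj (θ₁₂.value x)).2 := by
  rw [proj_value, proj_value]

/-- True by unfolding: both factors are evaluated at the same `x` and over the same base point `π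
x`. -/
theorem value_vcomp (θ₂₃ : Transformation f₂ f₃) (θ₁₂ : Transformation f₁ f₂) (x : P.X) :
    (θ₂₃.vcomp θ₁₂).value x =
      Q.mul (θ₂₃.value x) (θ₁₂.value x) (proj_value_vcomp θ₂₃ θ₁₂ x) := rfl

theorem vcomp_ident (θ : Transformation f₁ f₂) : θ.vcomp (ident f₁) = θ :=
  ext_value fun x => mul_unit _ (proj_value_vcomp θ (ident f₁) x)

theorem ident_vcomp (θ : Transformation f₁ f₂) : (ident f₂).vcomp θ = θ :=
  ext_value fun x => unit_mul _ (proj_value_vcomp (ident f₂) θ x)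

/-- Several bicategory axioms conjugate a whiskering by associators or unitors. When these are
identities, this is the shape that has to collapse. -/
theorem ident_vcomp_vcomp_ident (θ : Transformation f₁ f₂) :
    ((ident f₂).vcomp θ).vcomp (ident f₁) = θ := by
  rw [vcomp_ident, ident_vcomp]

theorem vcomp_assoc (θ₃₄ : Transformation f₃ f₄) (θ₂₃ : Transformation f₂ f₃)
    (θ₁₂ : Transformation f₁ f₂) :
    (θ₃₄.vcomp θ₂₃).vcomp θ₁₂ = θ₃₄.vcomp (θ₂₃.vcomp θ₁₂) :=
  ext_value fun _ => (Q.assoc _ _ _ (proj_value_vcomp _ _ _) (proj_value_vcomp _ _ _)).symm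

end

/-! ### Horizontal composition, whiskering and interchange -/

section

variable {P Q R : BundleGerbe EM M} {f f₁ f₂ f₃ : Morphism P Q} {g g₁ g₂ g₃ : Morphism Q R}

theorem proj_value_hcomp (ζ : Transformation g₁ g₂) (θ : Transformation f₁ f₂) (x : P.X) :
    (R.P.proj (g₂.fhat.toFun (θ.value x))).1 = (R.P.proj (ζ.value (f₁.f x))).2 := by
  rw [fhat_proj_of (proj_value θ x), proj_value]

/-- Not a pure unfolding: the composite evaluates `ζ` at the base point `P.π x`, whereas `ζ.value
(f₁.f x)` uses `Q.π (f₁.f x)`. The two agree because `f₁` is a map over `M`. -/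
theorem value_hcomp (ζ : Transformation g₁ g₂) (θ : Transformation f₁ f₂) (x : P.X) :
    (ζ.hcomp θ).value x =
      R.mul (g₂.fhat.toFun (θ.value x)) (ζ.value (f₁.f x)) (proj_value_hcomp ζ θ x) :=
  mul_congr (u := g₂.fhat.toFun (θ.value x)) rfl
    (dval_eq_value ζ (f₁.f x) ((f₁.π_f x).trans (ζ.proj_toFun _).symm))
    (hcomp_proj _ _ x (proj_value θ x) (proj_dval _ _ _))

/-- Precomposing with `f` only reindexes the components, since `ĝ₂` sends the unit to a unit. -/
theorem value_hcomp_ident (ζ : Transformation g₁ g₂) (x : P.X) :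
    (ζ.hcomp (ident f)).value x = ζ.value (f.f x) := by
  rw [value_hcomp, mul_congr ((congrArg g₂.fhat.toFun (value_ident x)).trans (g₂.map_unit _)) rfl,
    unit_mul]

/-- Postcomposing with `g` applies the functor `ĝ` to each component; the second factor is a unit.
-/
theorem value_ident_hcomp (θ : Transformation f₁ f₂) (x : P.X) :
    ((ident g).hcomp θ).value x = g.fhat.toFun (θ.value x) := by
  rw [value_hcomp]
  exact mul_unit _ _

/-- The horizontal composition in terms of the two whiskerings. -/
theorem hcomp_eq_vcomp (ζ : Transformation g₁ g₂) (θ : Transformation f₁ f₂) :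
    ζ.hcomp θ = (ζ.hcomp (ident f₂)).vcomp ((ident g₁).hcomp θ) := by
  refine ext_value fun x => ?_
  -- Naturality of `ζ` at the arrow `θ(x) : f₁ x → f₂ x` of `Q` reads `ζ(f₂ x) ĝ₁(θ(x)) = ĝ₂(θ(x))
  -- ζ(f₁ x)`. The right side is the horizontal composite.
  obtain ⟨_, _, h⟩ := matches_value ζ (θ.value x) (proj_value θ x)
  rw [value_hcomp, value_vcomp, mul_congr (value_hcomp_ident ζ x) (value_ident_hcomp θ x), h]

/-- The whiskerings in the other order. Here the components agree without naturality, so comparison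
with `hcomp_eq_vcomp` yields the interchange law. -/
theorem hcomp_eq_vcomp' (ζ : Transformation g₁ g₂) (θ : Transformation f₁ f₂) :
    ζ.hcomp θ = ((ident g₂).hcomp θ).vcomp (ζ.hcomp (ident f₁)) := by
  refine ext_value fun x => ?_
  rw [value_hcomp, value_vcomp, mul_congr (value_ident_hcomp θ x) (value_hcomp_ident ζ x)]

theorem ident_hcomp_ident : (ident g).hcomp (ident f) = ident (g.comp f) :=
  ext_value fun x => value_hcomp_ident _ x

theorem vcomp_hcomp_ident (ζ₂₃ : Transformation g₂ g₃) (ζ₁₂ : Transformation g₁ g₂) :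
    (ζ₂₃.vcomp ζ₁₂).hcomp (ident f) = (ζ₂₃.hcomp (ident f)).vcomp (ζ₁₂.hcomp (ident f)) :=
  ext_value fun x => by
    rw [value_hcomp_ident, value_vcomp, value_vcomp,
      mul_congr (value_hcomp_ident ζ₂₃ x) (value_hcomp_ident ζ₁₂ x)]

/-- Functoriality of postcomposition is multiplicativity of `ĝ`; on the other side,
`vcomp_hcomp_ident` needs only reindexing. -/
theorem ident_hcomp_vcomp (θ₂₃ : Transformation f₂ f₃) (θ₁₂ : Transformation f₁ f₂) :
    (ident g).hcomp (θ₂₃.vcomp θ₁₂) = ((ident g).hcomp θ₂₃).vcomp ((ident g).hcomp θ₁₂) :=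
  ext_value fun x => by
    rw [value_ident_hcomp, value_vcomp, value_vcomp, g.map_mul,
      mul_congr (value_ident_hcomp θ₂₃ x) (value_ident_hcomp θ₁₂ x)]

end

end Transformation

/-! ### Strict associativity and strict units -/

section strictness

variable {P Q R S : BundleGerbe EM M}

/-- That this and the next two equations hold by `rfl` matters: transformations between the two
sides then have the same type, and the laws below can be stated without transport. -/
theorem Morphism.comp_id (f : Morphism P Q) : f.comp (Morphism.id P) = f := rfl

theorem Morphism.id_comp (f : Morphism P Q) : (Morphism.id Q).comp f = f := rfl

theorem Morphism.comp_assoc (h : Morphism R S) (g : Morphism Q R) (f : Morphism P Q) :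
    (h.comp g).comp f = h.comp (g.comp f) := rfl

namespace Transformation

theorem hcomp_ident_id {f₁ f₂ : Morphism P Q} (θ : Transformation f₁ f₂) :
    θ.hcomp (ident (Morphism.id P)) = θ :=
  ext_value fun x => value_hcomp_ident θ x

theorem ident_id_hcomp {f₁ f₂ : Morphism P Q} (θ : Transformation f₁ f₂) :
    (ident (Morphism.id Q)).hcomp θ = θ :=
  ext_value fun x => value_ident_hcomp θ x

/-- At `x` both sides are the triple product of `ĥ₂(ĝ₂(θ(x)))`, `ĥ₂(ζ(f₁ x))` and `η(g₁(f₁ x))`,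
bracketed differently. -/
theorem hcomp_assoc {f₁ f₂ : Morphism P Q} {g₁ g₂ : Morphism Q R} {h₁ h₂ : Morphism R S}
    (η : Transformation h₁ h₂) (ζ : Transformation g₁ g₂) (θ : Transformation f₁ f₂) :
    (η.hcomp ζ).hcomp θ = η.hcomp (ζ.hcomp θ) := by
  refine ext_value fun x => ?_
  have k : (S.P.proj (h₂.fhat.toFun (g₂.fhat.toFun (θ.value x)))).1 =
      (S.P.proj (h₂.fhat.toFun (ζ.value (f₁.f x)))).2 := by
    rw [fhat_proj_of (fhat_proj_of (proj_value θ x)), fhat_proj_of (proj_value ζ _)]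
  -- On the right-hand side `ĥ₂` is applied to a product, and multiplicativity splits it into the
  -- first two of the three factors.
  have e : h₂.fhat.toFun ((ζ.hcomp θ).value x) =
      S.mul (h₂.fhat.toFun (g₂.fhat.toFun (θ.value x))) (h₂.fhat.toFun (ζ.value (f₁.f x))) k := by
    rw [value_hcomp, h₂.map_mul]
  calc ((η.hcomp ζ).hcomp θ).value x
      = S.mul (h₂.fhat.toFun (g₂.fhat.toFun (θ.value x))) ((η.hcomp ζ).value (f₁.f x))
          (proj_value_hcomp (η.hcomp ζ) θ x) := value_hcomp _ _ _
    _ = S.mul (h₂.fhat.toFun (g₂.fhat.toFun (θ.value x)))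
          (S.mul (h₂.fhat.toFun (ζ.value (f₁.f x))) (η.value (g₁.f (f₁.f x)))
            (proj_value_hcomp η ζ (f₁.f x))) (by rw [ProductMap.proj_app]; exact k) :=
        mul_congr rfl (value_hcomp η ζ (f₁.f x)) _
    _ = S.mul (S.mul (h₂.fhat.toFun (g₂.fhat.toFun (θ.value x)))
          (h₂.fhat.toFun (ζ.value (f₁.f x))) k) (η.value (g₁.f (f₁.f x)))
          (by rw [ProductMap.proj_app]; exact proj_value_hcomp η ζ (f₁.f x)) :=
        S.assoc _ _ _ k (proj_value_hcomp η ζ (f₁.f x))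
    _ = S.mul (h₂.fhat.toFun ((ζ.hcomp θ).value x)) (η.value (g₁.f (f₁.f x)))
          (proj_value_hcomp η (ζ.hcomp θ) x) := mul_congr e.symm rfl _
    _ = (η.hcomp (ζ.hcomp θ)).value x := (value_hcomp η (ζ.hcomp θ) x).symm

end Transformation

end strictness

/-! ### The strict bicategory and its comparison with the given operations -/

open Transformation

/-- Morphisms `P → Q` and transformations, with vertical composition. -/
@[reducible]
def homCategory (P Q : BundleGerbe EM M) : Category.{u} (Morphism P Q) where
  Hom := Transformation
  id := ident
  comp θ η := η.vcomp θ
  -- Categorical composition is written in diagrammatic order, `vcomp` in the order of maps, so the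
  -- left and right unit laws trade places.
  id_comp := vcomp_ident
  comp_id := ident_vcomp
  assoc _ _ _ := (vcomp_assoc _ _ _).symm

variable (EM M)

attribute [local instance] homCategory

/-- The bicategory of bundle gerbes on `M`, with identities as associators and unitors. -/
@[reducible]
def bicategory : Bicategory.{u, u} (BundleGerbe EM M) where
  Hom := Morphism
  id := Morphism.id
  comp f g := g.comp f
  homCategory := homCategory
  whiskerLeft f _ _ η := Transformation.hcomp η (ident f)
  whiskerRight θ g := Transformation.hcomp (ident g) θ
  -- Well typed because source and target are definitionally the same morphism; likewise for the
  -- unitors.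
  associator f g h := Iso.refl (h.comp (g.comp f))
  leftUnitor f := Iso.refl f
  rightUnitor f := Iso.refl f
  whiskerLeft_id _ _ := ident_hcomp_ident
  whiskerLeft_comp _ _ _ _ _ _ := vcomp_hcomp_ident _ _
  id_whiskerLeft η := (hcomp_ident_id η).trans (ident_vcomp_vcomp_ident η).symm
  comp_whiskerLeft f g h h' η := by
    -- The identity of a composite is the horizontal composite of the identities, so whiskering by a
    -- composite is an instance of horizontal associativity.
    have e : Transformation.hcomp η (ident (g.comp f)) =
        Transformation.hcomp (Transformation.hcomp η (ident g)) (ident f) := by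
      rw [hcomp_assoc, ident_hcomp_ident]
    exact e.trans (ident_vcomp_vcomp_ident _).symm
  id_whiskerRight _ _ := ident_hcomp_ident
  comp_whiskerRight _ _ _ := ident_hcomp_vcomp _ _
  whiskerRight_id η := (ident_id_hcomp η).trans (ident_vcomp_vcomp_ident η).symm
  whiskerRight_comp η g h := by
    have e : Transformation.hcomp (ident (h.comp g)) η =
        Transformation.hcomp (ident h) (Transformation.hcomp (ident g) η) := by
      rw [← hcomp_assoc, ident_hcomp_ident]
    exact e.trans (ident_vcomp_vcomp_ident _).symm
  whisker_assoc f _ _ η h :=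
    (hcomp_assoc (ident h) η (ident f)).symm.trans (ident_vcomp_vcomp_ident _).symm
  -- Both orders of whiskering equal the horizontal composite.
  whisker_exchange η θ := (hcomp_eq_vcomp' θ η).symm.trans (hcomp_eq_vcomp θ η)
  pentagon f g h i := by
    -- Of the pentagon's edges, only the two whiskered associators are not literally identity
    -- transformations; `e₁` and `e₂` turn them into identities.
    have e₁ := ident_hcomp_ident (f := h.comp (g.comp f)) (g := i)
    have e₂ := ident_hcomp_ident (f := f) (g := i.comp (h.comp g))
    exact congrArg₂ Transformation.vcomp
      ((congrArg₂ Transformation.vcomp e₂ rfl).trans (vcomp_ident _)) e₁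
  -- With identity unitors both whiskered edges are the same transformation, and the remaining edge
  -- is an identity.
  triangle f g := vcomp_ident (Transformation.hcomp (ident g) (ident f))

theorem bicategory_strict : @Bicategory.Strict (BundleGerbe EM M) (bicategory EM M) := by
  let _ := bicategory EM M
  exact
    { id_comp := Morphism.comp_id
      comp_id := Morphism.id_comp
      assoc := fun f g h => (Morphism.comp_assoc h g f).symm
      -- Since the 1-arrow laws are definitional, `eqToIso` of them reduces to `Iso.refl`.
      leftUnitor_eqToIso := fun _ => rfl
      rightUnitor_eqToIso := fun _ => rfl
      associator_eqToIso := fun _ _ _ => rfl }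

/-- Only horizontal composition needs an argument: a bicategory yields it as two successive
whiskerings, and `hcomp_eq_vcomp` identifies these with the prescribed formula. The remaining
operations agree by definition. -/
theorem ofBicategory_bicategory :
    @TwoCategoryData.ofBicategory (BundleGerbe EM M) (bicategory EM M) =
      twoCategoryData EM M := by
  -- All arguments are made explicit so that function extensionality applies to the operation as a
  -- whole; `congrArg` then carries the equality through the constructor.
  have h : (fun (a b c : BundleGerbe EM M) (f₁ f₂ : Morphism a b) (g₁ g₂ : Morphism b c)
      (η : Transformation g₁ g₂) (θ : Transformation f₁ f₂) =>
        (η.hcomp (ident f₂)).vcomp ((ident g₁).hcomp θ)) =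
      fun _ _ _ _ _ _ _ η θ => η.hcomp θ := by
    funext a b c f₁ f₂ g₁ g₂ η θ
    exact (hcomp_eq_vcomp η θ).symm
  exact congrArg (fun H => TwoCategoryData.mk Morphism Transformation Morphism.id Morphism.comp
    vcomp fun {a b c f₁ f₂ g₁ g₂} => H a b c f₁ f₂ g₁ g₂) h

end CstarGerbe.BundleGerbe

end

/-- The equality of operations ties the existential to the compositions described; strictness alone
would not. Identity 2-arrows need no clause of their own, being the neutral elements of vertical
composition. -/
theorem proposition3p4p11 {EM : Type u} [NormedAddCommGroup EM] [NormedSpace ℝ EM]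
    {M : Type u} [TopologicalSpace M] [ChartedSpace EM M] [IsManifold 𝓘(ℝ, EM) ∞ M] :
    ∃ B : CategoryTheory.Bicategory.{u, u} (CstarGerbe.BundleGerbe EM M),
      @CategoryTheory.Bicategory.Strict (CstarGerbe.BundleGerbe EM M) B ∧
      @CstarGerbe.TwoCategoryData.ofBicategory (CstarGerbe.BundleGerbe EM M) B =
        CstarGerbe.BundleGerbe.twoCategoryData EM M :=
  ⟨CstarGerbe.BundleGerbe.bicategory EM M, CstarGerbe.BundleGerbe.bicategory_strict EM M,
    CstarGerbe.BundleGerbe.ofBicategory_bicategory EM M⟩
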